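/- Let $\mathbb M_2$ be the algebra of complex $2\times 2$ matrices with the operator norm and let $\ell_\infty(\mathbb N,\mathbb M_2)$ be the $\mathrm C^*$-algebra of bounded sequences in $\mathbb M_2$ with the supremum norm. A Banach algebra $\mathcal A$ is amenable if every bounded derivation from $\mathcal A$ into the dual of a Banach $\mathcal A$-bimodule is inner, and it is $C$-amenable if it has an approximate diagonal bounded by $C$, that is, a net $(m_\alpha)$ in $\mathcal A\otimes\mathcal A$ with projective tensor norms $\|m_\alpha\|\le C$ such that $a\cdot m_\alpha-m_\alpha\cdot a\to 0$ in the projective tensor norm and $\Delta(m_\alpha)a\to a$ for every $a\in\mathcal A$, where $\Delta(x\otimes y)=xy$, $a\cdot(x\otimes y)=ax\otimes y$ and $(x\otimes y)\cdot a=x\otimes ya$. **Theorem.** For every $\varepsilon>0$ there is a norm-closed subalgebra $\mathcal A\subset\ell_\infty(\mathbb N,\mathbb M_2)$ containing the unit such that: 1. $\mathcal A$ is amenable, and in fact $(1+\varepsilon)$-amenable; 2. $\mathcal A$ is not isomorphic to a $\mathrm C^*$-algebra, i.e. there is no algebra isomorphism of $\mathcal A$ onto a $\mathrm C^*$-algebra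 that is bounded with bounded inverse; 3. the density character of $\mathcal A$ (the least cardinality of a dense subset) is $\aleph_1$; 4. $\mathcal A$ is the inductive limit of norm-closed separable subalgebras $\mathcal A_i$, $i<\aleph_1$, each containing the unit of $\ell_\infty(\mathbb N,\mathbb M_2)$ (that is, $\mathcal A_i\subset\mathcal A_j$ for $i\le j<\aleph_1$, and $\mathcal A$ is the closure of $\bigcup_{i}\mathcal A_i$), and there are invertible elements $v_i\in\ell_\infty(\mathbb N,\mathbb M_2)$ such that $v_i\mathcal A_iv_i^{-1}$ is a $\mathrm C^*$-subalgebra of $\ell_\infty(\mathbb N,\mathbb M_2)$ for every $i$ and $\sup_i\|v_i\|\,\|v_i^{-1}\|<\infty$. -/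

import Mathlib

open scoped Matrix.Norms.L2Operator ENNReal TensorProduct Ordinal Cardinal Topology
open Filter

noncomputable section

/-- The C*-algebra `ℓ∞(ℕ, M₂)` of bounded sequences of complex `2 × 2` matrices, where `M₂`
carries the operator norm (coming from the Euclidean norm on `ℂ²`) and the algebra carries the
supremum norm, with coordinatewise multiplication and adjoint. -/
abbrev EllInftyM2 : Type := lp (fun _ : ℕ => Matrix (Fin 2) (Fin 2) ℂ) ∞

section Amenability

/-- A Banach `A`-bimodule structure on a Banach space `X`: a bounded left action and a bounded
right action (so `left a x = a · x` and `right a x = x · a`) which commute. -/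
structure BanachBimodule (A X : Type*) [NormedRing A] [NormedAlgebra ℂ A]
    [NormedAddCommGroup X] [NormedSpace ℂ X] where
  left : A →L[ℂ] X →L[ℂ] X
  right : A →L[ℂ] X →L[ℂ] X
  left_mul : ∀ a b x, left (a * b) x = left a (left b x)
  right_mul : ∀ a b x, right (a * b) x = right b (right a x)
  left_right : ∀ a b x, left a (right b x) = right b (left a x)

/-- A bounded linear map `D : A → X*` is a derivation, where the dual `X*` has the dual bimodule
structure `(a · φ)(x) = φ(x · a)` and `(φ · a)(x) = φ(a · x)`: that is,
`D(ab) = a · D(b) + D(a) · b`. -/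
def BanachBimodule.IsDualDerivation {A X : Type*} [NormedRing A] [NormedAlgebra ℂ A]
    [NormedAddCommGroup X] [NormedSpace ℂ X] (M : BanachBimodule A X)
    (D : A →L[ℂ] StrongDual ℂ X) : Prop :=
  ∀ a b x, D (a * b) x = D b (M.right a x) + D a (M.left b x)

/-- The map `D : A → X*` is an inner derivation: `D(a) = a · φ - φ · a` for some `φ ∈ X*`. -/
def BanachBimodule.IsDualInner {A X : Type*} [NormedRing A] [NormedAlgebra ℂ A]
    [NormedAddCommGroup X] [NormedSpace ℂ X] (M : BanachBimodule A X)
    (D : A →L[ℂ] StrongDual ℂ X) : Prop :=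
  ∃ φ : StrongDual ℂ X, ∀ a x, D a x = φ (M.right a x) - φ (M.left a x)

/-- Amenability of a Banach algebra (Johnson): every bounded derivation into the dual of a Banach
bimodule is inner. -/
def IsAmenableBanachAlgebra (A : Type) [NormedRing A] [NormedAlgebra ℂ A] : Prop :=
  ∀ (X : Type) [NormedAddCommGroup X] [NormedSpace ℂ X] [CompleteSpace X]
    (M : BanachBimodule A X) (D : A →L[ℂ] StrongDual ℂ X),
    M.IsDualDerivation D → M.IsDualInner D

/-- The projective tensor (semi)norm on `A ⊗ A`:
`‖u‖ = inf {∑ ‖aᵢ‖ ‖bᵢ‖ : u = ∑ aᵢ ⊗ bᵢ, a finite sum}`. -/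
def projectiveTensorNorm {A : Type*} [NormedRing A] [NormedAlgebra ℂ A] (u : A ⊗[ℂ] A) : ℝ :=
  sInf {r : ℝ | ∃ (n : ℕ) (a b : Fin n → A),
    u = ∑ i, a i ⊗ₜ[ℂ] b i ∧ r = ∑ i, ‖a i‖ * ‖b i‖}

/-- `A` is `C`-amenable: there is an approximate diagonal for `A` bounded by `C`, i.e. a net
`(mᵢ)` in `A ⊗ A` of projective tensor norm at most `C` such that, for every `a ∈ A`,
`a · mᵢ - mᵢ · a → 0` in projective tensor norm and `Δ(mᵢ) a → a` in `A`. Here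
`a · (x ⊗ y) = ax ⊗ y`, `(x ⊗ y) · a = x ⊗ ya`, and `Δ(x ⊗ y) = xy`. -/
def IsCAmenable (C : ℝ) (A : Type) [NormedRing A] [NormedAlgebra ℂ A] : Prop :=
  ∃ (ι : Type) (l : Filter ι) (m : ι → A ⊗[ℂ] A), l.NeBot ∧
    (∀ i, projectiveTensorNorm (m i) ≤ C) ∧
    (∀ a : A, Tendsto (fun i => projectiveTensorNorm
      ((LinearMap.mulLeft ℂ a).rTensor A (m i) - (LinearMap.mulRight ℂ a).lTensor A (m i)))
      l (𝓝 0)) ∧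
    (∀ a : A, Tendsto (fun i => LinearMap.mul' ℂ A (m i) * a) l (𝓝 a))

end Amenability

/-- The density character of a topological space: the least cardinality of a dense subset. -/
def densityCharacter (X : Type*) [TopologicalSpace X] : Cardinal :=
  sInf {κ : Cardinal | ∃ s : Set X, Dense s ∧ #s = κ}

/-- A Banach algebra is isomorphic to a C*-algebra: there is an algebra isomorphism onto a
C*-algebra that is bounded with bounded inverse. (It need not be isometric.) -/
def IsIsomorphicToCStarAlgebra (A : Type) [NormedRing A] [NormedAlgebra ℂ A] : Prop :=
  ∃ (B : Type) (_ : CStarAlgebra B), Nonempty (A ≃A[ℂ] B)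

end

/-! Take ℵ₁ pairs (E_i, F_i) of disjoint subsets of ℕ such that sets from different pairs have
finite intersection, yet for i ≠ j one of E_i ∩ F_j, F_i ∩ E_j is nonempty (a Luzin gap). Countable
subfamilies can be separated (`IsLuzinFamily.exists_separation`), but a pigeonhole on finite codes
shows that no single X almost contains every E_i and almost misses every F_i
(`IsLuzinFamily.not_separated`). Let p = `obliqueIdem 0` be the orthogonal projection onto ℂe₀ and q
= `obliqueIdem s` an oblique idempotent with the same range, s > 0 small. The algebra A is the
closed unital algebra generated by the null sequences, the sequences equal to p on E_i and those
equal to q on F_i (zero elsewhere). It is commutative modulo null sequences.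

Amenability: finitely many generators lie in the span of a finite group in A, made of signed
permutations in the first N coordinates and of the symmetries 1 - 2p, 1 - 2q on blocks beyond N. Its
elements have norm at most 1 + 2s, so averaging g ⊗ g⁻¹ gives a diagonal of norm at most (1 + 2s)²
(`isCAmenable_blockAlgebra`). A limit of such diagonals along an ultrafilter makes derivations
inner.

Not a C*-algebra: an isomorphism from a C*-algebra maps its unitaries to a bounded group, which in
each coordinate n preserves a hermitian form h_n with uniform bounds (`exists_invariant_form`).
Hence A is closed under adjoints with respect to (h_n). An idempotent asymptotically commutes with
its adjoint, so its range and kernel are asymptotically h_n-orthogonal (`norm_offdiag_le`): the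
entry h_n 0 1 tends to 0 along E_i, and is asymptotic to s · h_n 0 0, bounded below, along F_i. The
set where |h_n 0 1| is small would then separate the gap.

Similarity and density: for countably many indices, a shear on a separating set X turns q into p up
to null sequences, and the algebra generated with p alone is self-adjoint. The norms of the shears
depend on s only. The union over initial segments of ω₁ has ℵ₁ separable pieces, while the sequences
equal to p on E_i are 1-separated. -/

noncomputable section

/-! ### The projective tensor norm and the commutator a · m - m · a. -/

section ProjectiveNorm

variable {A : Type*} [NormedRing A] [NormedAlgebra ℂ A]

theorem projectiveTensorNorm_bddBelow (u : A ⊗[ℂ] A) :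
    BddBelow {r : ℝ | ∃ (n : ℕ) (a b : Fin n → A),
      u = ∑ i, a i ⊗ₜ[ℂ] b i ∧ r = ∑ i, ‖a i‖ * ‖b i‖} := by
  refine ⟨0, ?_⟩
  rintro r ⟨n, a, b, -, rfl⟩
  positivity

theorem projectiveTensorNorm_nonneg (u : A ⊗[ℂ] A) : 0 ≤ projectiveTensorNorm u := by
  apply Real.sInf_nonneg
  rintro r ⟨n, a, b, -, rfl⟩
  positivity

theorem projectiveTensorNorm_sum_tmul_le {κ : Type*} [Fintype κ] (a b : κ → A) :
    projectiveTensorNorm (∑ i, a i ⊗ₜ[ℂ] b i) ≤ ∑ i, ‖a i‖ * ‖b i‖ := by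
  let e := (Fintype.equivFin κ).symm
  refine csInf_le (projectiveTensorNorm_bddBelow _)
    ⟨Fintype.card κ, a ∘ e, b ∘ e, ?_, ?_⟩
  · exact (Equiv.sum_comp e fun i => a i ⊗ₜ[ℂ] b i).symm
  · exact (Equiv.sum_comp e fun i => ‖a i‖ * ‖b i‖).symm

theorem exists_eq_sum_tmul (u : A ⊗[ℂ] A) :
    ∃ (n : ℕ) (a b : Fin n → A), u = ∑ i, a i ⊗ₜ[ℂ] b i := by
  induction u with
  | zero => exact ⟨0, 0, 0, by simp⟩
  | tmul x y => exact ⟨1, fun _ => x, fun _ => y, by simp⟩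
  | add u v hu hv =>
    obtain ⟨n, a, b, rfl⟩ := hu
    obtain ⟨k, c, d, rfl⟩ := hv
    exact ⟨n + k, Fin.append a c, Fin.append b d, by simp [Fin.sum_univ_add]⟩

theorem exists_sum_tmul_lt (u : A ⊗[ℂ] A) {C : ℝ} (hC : projectiveTensorNorm u < C) :
    ∃ (n : ℕ) (a b : Fin n → A), u = ∑ i, a i ⊗ₜ[ℂ] b i ∧ ∑ i, ‖a i‖ * ‖b i‖ < C := by
  obtain ⟨n, a, b, h⟩ := exists_eq_sum_tmul u
  have hne : {r : ℝ | ∃ (n : ℕ) (a b : Fin n → A),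
      u = ∑ i, a i ⊗ₜ[ℂ] b i ∧ r = ∑ i, ‖a i‖ * ‖b i‖}.Nonempty := ⟨_, n, a, b, h, rfl⟩
  obtain ⟨r, ⟨n, a, b, h, rfl⟩, hr⟩ := exists_lt_of_csInf_lt hne hC
  exact ⟨n, a, b, h, hr⟩

theorem projectiveTensorNorm_add_le (u v : A ⊗[ℂ] A) :
    projectiveTensorNorm (u + v) ≤ projectiveTensorNorm u + projectiveTensorNorm v := by
  refine le_of_forall_pos_le_add fun δ hδ => ?_
  obtain ⟨n, a, b, hu, h⟩ := exists_sum_tmul_lt u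
    (lt_add_of_pos_right (projectiveTensorNorm u) (half_pos hδ))
  obtain ⟨k, c, d, hv, h'⟩ := exists_sum_tmul_lt v
    (lt_add_of_pos_right (projectiveTensorNorm v) (half_pos hδ))
  have key := projectiveTensorNorm_sum_tmul_le (Fin.append a c) (Fin.append b d)
  simp only [Fin.sum_univ_add, Fin.append_left, Fin.append_right, ← hu, ← hv] at key
  linarith

/-- A linear map of tensors that acts on elementary tensors as `x ⊗ y ↦ f x ⊗ g y`, with
`‖f x‖ ‖g y‖ ≤ C ‖x‖ ‖y‖`, increases the projective norm at most by the factor `C`. -/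
theorem projectiveTensorNorm_map_le {F : A ⊗[ℂ] A →ₗ[ℂ] A ⊗[ℂ] A} {f g : A → A} {C : ℝ}
    (hC : 0 ≤ C) (hF : ∀ x y, F (x ⊗ₜ y) = f x ⊗ₜ g y)
    (hfg : ∀ x y, ‖f x‖ * ‖g y‖ ≤ C * (‖x‖ * ‖y‖)) (u : A ⊗[ℂ] A) :
    projectiveTensorNorm (F u) ≤ C * projectiveTensorNorm u := by
  refine le_of_forall_pos_le_add fun δ hδ => ?_
  -- Dividing by `C + 1` rather than `C` allows `C = 0`.
  obtain ⟨n, a, b, hu, h⟩ := exists_sum_tmul_lt u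
    (lt_add_of_pos_right (projectiveTensorNorm u) (div_pos hδ (by positivity : 0 < C + 1)))
  have key := projectiveTensorNorm_sum_tmul_le (fun i => f (a i)) (fun i => g (b i))
  have h1 : F u = ∑ i, f (a i) ⊗ₜ[ℂ] g (b i) := by simp [hu, map_sum, hF]
  rw [← h1] at key
  calc projectiveTensorNorm (F u) ≤ ∑ i, ‖f (a i)‖ * ‖g (b i)‖ := key
    _ ≤ ∑ i, C * (‖a i‖ * ‖b i‖) := Finset.sum_le_sum fun i _ => hfg _ _
    _ = C * ∑ i, ‖a i‖ * ‖b i‖ := by rw [Finset.mul_sum]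
    _ ≤ C * (projectiveTensorNorm u + δ / (C + 1)) := by gcongr
    _ = C * projectiveTensorNorm u + δ * (C / (C + 1)) := by ring
    _ ≤ C * projectiveTensorNorm u + δ * 1 := by
      gcongr
      rw [div_le_one (by positivity)]
      linarith
    _ = _ := by ring

/-- The map `m ↦ a · m - m · a` on `A ⊗ A`. -/
def tensorCommutator (a : A) : A ⊗[ℂ] A →ₗ[ℂ] A ⊗[ℂ] A :=
  (LinearMap.mulLeft ℂ a).rTensor A - (LinearMap.mulRight ℂ a).lTensor A

theorem tensorCommutator_tmul (a x y : A) :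
    tensorCommutator a (x ⊗ₜ[ℂ] y) = (a * x) ⊗ₜ y - x ⊗ₜ (y * a) := by
  simp [tensorCommutator]

theorem tensorCommutator_add (a b : A) (m : A ⊗[ℂ] A) :
    tensorCommutator (a + b) m = tensorCommutator a m + tensorCommutator b m := by
  induction m with
  | zero => simp
  | tmul x y =>
    simp only [tensorCommutator_tmul, add_mul, mul_add, TensorProduct.add_tmul,
      TensorProduct.tmul_add]
    abel
  | add u v hu hv => simp only [map_add, hu, hv]; abel

/-- Each one-sided multiplication by `a` costs a factor `‖a‖`. This continuity in `a` extends
asymptotic commutation from a dense subalgebra to the whole algebra. -/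
theorem projectiveTensorNorm_tensorCommutator_le (a : A) (m : A ⊗[ℂ] A) :
    projectiveTensorNorm (tensorCommutator a m) ≤ 2 * ‖a‖ * projectiveTensorNorm m := by
  have h1 : projectiveTensorNorm ((LinearMap.mulLeft ℂ a).rTensor A m)
      ≤ ‖a‖ * projectiveTensorNorm m := by
    refine projectiveTensorNorm_map_le (f := fun x => a * x) (g := id) (norm_nonneg a)
      (by simp) (fun x y => ?_) m
    rw [← mul_assoc]
    exact mul_le_mul_of_nonneg_right (norm_mul_le _ _) (norm_nonneg _)
  have h2 : projectiveTensorNorm ((-(LinearMap.mulRight ℂ a).lTensor A) m)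
      ≤ ‖a‖ * projectiveTensorNorm m := by
    refine projectiveTensorNorm_map_le (f := fun x => -x) (g := fun y => y * a) (norm_nonneg a)
      (by simp [TensorProduct.neg_tmul]) (fun x y => ?_) m
    rw [norm_neg]
    calc ‖x‖ * ‖y * a‖ ≤ ‖x‖ * (‖y‖ * ‖a‖) := by gcongr; exact norm_mul_le _ _
      _ = _ := by ring
  have h3 := projectiveTensorNorm_add_le ((LinearMap.mulLeft ℂ a).rTensor A m)
    ((-(LinearMap.mulRight ℂ a).lTensor A) m)
  have h4 : tensorCommutator a m = (LinearMap.mulLeft ℂ a).rTensor A m +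
    ((-(LinearMap.mulRight ℂ a).lTensor A) m) := by
    simp [tensorCommutator, sub_eq_add_neg]
  rw [h4]
  linarith

/-- The elements of `A` that commute with a given tensor. -/
def tensorCommutant (m : A ⊗[ℂ] A) : Subalgebra ℂ A where
  carrier := {a | tensorCommutator a m = 0}
  mul_mem' {a b} ha hb := by
    -- Leibniz rule: ab · m - m · ab = a · (b · m - m · b) + (a · m - m · a) · b.
    have key : ∀ m : A ⊗[ℂ] A, tensorCommutator (a * b) m =
        (LinearMap.mulLeft ℂ a).rTensor A (tensorCommutator b m) +
        (LinearMap.mulRight ℂ b).lTensor A (tensorCommutator a m) := by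
      intro m
      induction m with
      | zero => simp
      | tmul x y => simp [tensorCommutator_tmul, mul_assoc]
      | add u v hu hv => simp only [map_add, hu, hv]; abel
    rw [Set.mem_ofPred_eq] at *
    rw [key, ha, hb, map_zero, map_zero, add_zero]
  add_mem' {a b} ha hb := by
    rw [Set.mem_ofPred_eq] at *
    rw [tensorCommutator_add, ha, hb, add_zero]
  algebraMap_mem' r := by
    rw [Set.mem_ofPred_eq]
    induction m with
    | zero => simp
    | tmul x y =>
      rw [tensorCommutator_tmul, ← Algebra.smul_def, ← Algebra.commutes, ← Algebra.smul_def,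
        TensorProduct.smul_tmul, sub_self]
    | add u v hu hv => rw [map_add, hu, hv, add_zero]

theorem mem_tensorCommutant {m : A ⊗[ℂ] A} {a : A} :
    a ∈ tensorCommutant m ↔ tensorCommutator a m = 0 := Iff.rfl

end ProjectiveNorm

/-! ### Approximate diagonals from finite groups. -/

section ApproximateDiagonal

/-- A Banach algebra topologically generated by a set `T`, such that each finite part of `T`
commutes with a tensor `m` of norm at most `C` with `Δ(m) = 1`, is `C`-amenable. -/
theorem isCAmenable_of_finite_subsets {A : Type} [NormedRing A] [NormedAlgebra ℂ A] {C : ℝ}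
    (T : Set A) (hT : Dense (Algebra.adjoin ℂ T : Set A))
    (h : ∀ S : Finset T, ∃ m : A ⊗[ℂ] A, projectiveTensorNorm m ≤ C ∧
      LinearMap.mul' ℂ A m = 1 ∧ ∀ a ∈ S, tensorCommutator (a : A) m = 0) :
    IsCAmenable C A := by
  classical
  choose m hm h1 hcomm using h
  have hC : 0 ≤ C := (projectiveTensorNorm_nonneg _).trans (hm ∅)
  refine ⟨Finset T, atTop, m, inferInstance, hm, fun a => ?_, fun a => by simp [h1]⟩
  rw [Metric.tendsto_nhds]
  intro δ hδ
  obtain ⟨b, hb, hab⟩ := Metric.dense_iff.1 hT a (δ / (2 * C + 1)) (by positivity)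
  rw [Metric.mem_ball, dist_comm, dist_eq_norm] at hb
  have hev : ∀ᶠ S in atTop, b ∈ tensorCommutant (m S) := by
    refine Algebra.adjoin_induction (p := fun b _ => ∀ᶠ S in atTop, b ∈ tensorCommutant (m S))
      (fun x hx => ?_) (fun r => Eventually.of_forall fun S => Subalgebra.algebraMap_mem _ r)
      (fun x y _ _ hx hy => ?_) (fun x y _ _ hx hy => ?_) hab
    · filter_upwards [eventually_ge_atTop {(⟨x, hx⟩ : T)}] with S hS
      exact hcomm S ⟨x, hx⟩ (hS (Finset.mem_singleton_self _))
    · filter_upwards [hx, hy] with S h h' using add_mem h h'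
    · filter_upwards [hx, hy] with S h h' using mul_mem h h'
  filter_upwards [hev] with S hS
  rw [Real.dist_0_eq_abs, abs_of_nonneg (projectiveTensorNorm_nonneg _)]
  change projectiveTensorNorm (tensorCommutator a (m S)) < δ
  -- Since `b` commutes exactly with `m S`, only the small difference `a - b` contributes.
  have hS' : tensorCommutator a (m S) = tensorCommutator (a - b) (m S) := by
    conv_lhs => rw [← sub_add_cancel a b, tensorCommutator_add, mem_tensorCommutant.1 hS, add_zero]
  rw [hS']
  calc _ ≤ 2 * ‖a - b‖ * projectiveTensorNorm (m S) :=
        projectiveTensorNorm_tensorCommutator_le _ _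
    _ ≤ 2 * (δ / (2 * C + 1)) * C := by
      gcongr
      · exact projectiveTensorNorm_nonneg _
      · exact hm S
    _ = δ * ((2 * C) / (2 * C + 1)) := by ring
    _ < δ * 1 := by
      gcongr
      rw [div_lt_one (by positivity)]
      linarith
    _ = δ := mul_one δ

/-- Averaging `g ⊗ g⁻¹` over a finite group of invertible elements of `A` gives a tensor
commuting with the group. -/
theorem exists_diagonal_of_finite_group {A : Type*} [NormedRing A] [NormedAlgebra ℂ A]
    {G : Type*} [Group G] [Finite G] (ρ : G →* A) {C : ℝ}
    (hρ : ∀ g, ‖ρ g‖ * ‖ρ g⁻¹‖ ≤ C) :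
    ∃ m : A ⊗[ℂ] A, projectiveTensorNorm m ≤ C ∧ LinearMap.mul' ℂ A m = 1 ∧
      ∀ a ∈ Algebra.adjoin ℂ (Set.range ρ), tensorCommutator a m = 0 := by
  have := Fintype.ofFinite G
  have hcard : (Fintype.card G : ℂ) ≠ 0 := Nat.cast_ne_zero.2 Fintype.card_ne_zero
  have hcard' : (0 : ℝ) < Fintype.card G := Nat.cast_pos.2 Fintype.card_pos
  refine ⟨∑ g, ((Fintype.card G : ℂ)⁻¹ • ρ g) ⊗ₜ ρ g⁻¹, ?_, ?_, ?_⟩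
  · refine (projectiveTensorNorm_sum_tmul_le _ _).trans ?_
    calc _ ≤ ∑ _g : G, (Fintype.card G : ℝ)⁻¹ * C := by
          refine Finset.sum_le_sum fun g _ => ?_
          rw [norm_smul, mul_assoc, norm_inv, Complex.norm_natCast]
          gcongr
          exact hρ g
      _ = C := by simp [hcard'.ne']
  · simp only [map_sum, LinearMap.mul'_apply, smul_mul_assoc, ← map_mul, mul_inv_cancel, map_one]
    rw [← Finset.sum_smul, Finset.sum_const, Finset.card_univ, nsmul_eq_mul,
      mul_inv_cancel₀ hcard, one_smul]
  · intro a ha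
    rw [← mem_tensorCommutant]
    refine Algebra.adjoin_le ?_ ha
    rintro _ ⟨k, rfl⟩
    rw [SetLike.mem_coe, mem_tensorCommutant, map_sum]
    simp only [tensorCommutator_tmul, Finset.sum_sub_distrib]
    -- The substitution g ↦ kg turns ∑ g ⊗ g⁻¹k into ∑ kg ⊗ g⁻¹.
    rw [sub_eq_zero, ← Equiv.sum_comp (Equiv.mulLeft k)
      (fun g => ((Fintype.card G : ℂ)⁻¹ • ρ g) ⊗ₜ[ℂ] (ρ g⁻¹ * ρ k))]
    refine Finset.sum_congr rfl fun g _ => ?_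
    rw [mul_smul_comm, Equiv.coe_mulLeft, ← map_mul, ← map_mul]
    simp

end ApproximateDiagonal

/-! ### Johnson's theorem: a bounded approximate diagonal gives amenability. -/

section Johnson

variable {A X : Type} [NormedRing A] [NormedAlgebra ℂ A] [NormedAddCommGroup X] [NormedSpace ℂ X]

/-- For a derivation `D : A → X*` and `x ∈ X`, the functional `a ⊗ b ↦ (a · D b) x`. -/
def BanachBimodule.tensorFunctional (M : BanachBimodule A X) (D : A →L[ℂ] StrongDual ℂ X) (x : X) :
    A ⊗[ℂ] A →ₗ[ℂ] ℂ :=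
  TensorProduct.lift (LinearMap.mk₂ ℂ (fun a b => D b (M.right a x))
    (by simp) (by simp) (by simp) (by simp))

theorem BanachBimodule.tensorFunctional_tmul (M : BanachBimodule A X)
    (D : A →L[ℂ] StrongDual ℂ X) (x : X) (a b : A) :
    M.tensorFunctional D x (a ⊗ₜ b) = D b (M.right a x) := by
  simp [tensorFunctional]

theorem BanachBimodule.norm_tensorFunctional_le (M : BanachBimodule A X)
    (D : A →L[ℂ] StrongDual ℂ X) (x : X) (u : A ⊗[ℂ] A) :
    ‖M.tensorFunctional D x u‖ ≤ ‖D‖ * ‖M.right‖ * ‖x‖ * projectiveTensorNorm u := by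
  set K := ‖D‖ * ‖M.right‖ * ‖x‖ with hK
  have hK0 : 0 ≤ K := by positivity
  refine le_of_forall_pos_le_add fun δ hδ => ?_
  obtain ⟨n, a, b, hu, h⟩ := exists_sum_tmul_lt u
    (lt_add_of_pos_right (projectiveTensorNorm u) (div_pos hδ (by positivity : 0 < K + 1)))
  calc ‖M.tensorFunctional D x u‖ = ‖∑ i, D (b i) (M.right (a i) x)‖ := by
        rw [hu, map_sum]; simp only [M.tensorFunctional_tmul]
    _ ≤ ∑ i, K * (‖a i‖ * ‖b i‖) := by
      refine norm_sum_le_of_le _ fun i _ => ?_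
      calc _ ≤ ‖D (b i)‖ * ‖M.right (a i) x‖ := (D (b i)).le_opNorm _
        _ ≤ (‖D‖ * ‖b i‖) * (‖M.right‖ * ‖a i‖ * ‖x‖) := by
          gcongr
          · exact D.le_opNorm _
          · exact M.right.le_opNorm₂ _ _
        _ = _ := by rw [hK]; ring
    _ = K * ∑ i, ‖a i‖ * ‖b i‖ := by rw [Finset.mul_sum]
    _ ≤ K * (projectiveTensorNorm u + δ / (K + 1)) := by gcongr
    _ = K * projectiveTensorNorm u + δ * (K / (K + 1)) := by ring
    _ ≤ K * projectiveTensorNorm u + δ * 1 := by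
      gcongr
      rw [div_le_one (by positivity)]
      linarith
    _ = _ := by ring

/-- On b ⊗ c this is the derivation rule for D(ca). When `m` runs through an approximate diagonal
the commutator term vanishes and Δ(m) tends to 1, so the limit functional implements D up to the
action of 1. -/
theorem BanachBimodule.tensorFunctional_right_sub_left (M : BanachBimodule A X)
    {D : A →L[ℂ] StrongDual ℂ X} (hD : M.IsDualDerivation D) (a : A) (x : X) (m : A ⊗[ℂ] A) :
    M.tensorFunctional D (M.right a x) m - M.tensorFunctional D (M.left a x) m =
      M.tensorFunctional D x (tensorCommutator a m) +
        D a (M.right (LinearMap.mul' ℂ A m) x) := by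
  induction m with
  | zero => simp
  | tmul b c =>
    rw [tensorCommutator_tmul, map_sub]
    simp only [M.tensorFunctional_tmul, LinearMap.mul'_apply, hD c a, M.right_mul, M.left_right]
    ring
  | add u v hu hv =>
    simp only [map_add, add_apply] at hu hv ⊢
    linear_combination hu + hv

/-- A unital Banach algebra with a bounded approximate diagonal is amenable. -/
theorem IsCAmenable.isAmenableBanachAlgebra {C : ℝ} (h : IsCAmenable C A) :
    IsAmenableBanachAlgebra A := by
  intro X _ _ _ M D hD
  obtain ⟨ι, l, m, hl, hC, hcomm, hone⟩ := h
  have hone' : Tendsto (fun i => LinearMap.mul' ℂ A (m i)) l (𝓝 1) := by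
    simpa using hone 1
  let U : Ultrafilter ι := Ultrafilter.of l
  have hU : (U : Filter ι) ≤ l := Ultrafilter.of_le l
  have hbound : ∀ x i, ‖M.tensorFunctional D x (m i)‖ ≤ ‖D‖ * ‖M.right‖ * C * ‖x‖ := fun x i =>
    (M.norm_tensorFunctional_le D x (m i)).trans (by
      calc _ ≤ ‖D‖ * ‖M.right‖ * ‖x‖ * C := by gcongr; exact hC i
        _ = _ := by ring)
  have hlim : ∀ x, ∃ z, Tendsto (fun i => M.tensorFunctional D x (m i)) U (𝓝 z) := by
    intro x
    obtain ⟨z, -, hz⟩ := (isCompact_closedBall (0 : ℂ) (‖D‖ * ‖M.right‖ * C * ‖x‖)).ultrafilter_le_nhds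
      (U.map fun i => M.tensorFunctional D x (m i)) (by
        rw [Ultrafilter.coe_map, le_principal_iff]
        exact Filter.mem_map.2 (Filter.univ_mem' fun i => by simpa using hbound x i))
    exact ⟨z, hz⟩
  choose φ hφ using hlim
  let φ' : StrongDual ℂ X := LinearMap.mkContinuous
    { toFun := φ
      map_add' := fun x y => tendsto_nhds_unique (hφ (x + y)) (by
        refine ((hφ x).add (hφ y)).congr fun i => ?_
        induction m i with
        | zero => simp
        | tmul a b => simp [M.tensorFunctional_tmul]
        | add u v hu hv => simp only [map_add] at *; linear_combination hu + hv)
      map_smul' := fun c x => tendsto_nhds_unique (hφ (c • x)) (by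
        refine ((hφ x).const_smul c).congr fun i => ?_
        induction m i with
        | zero => simp
        | tmul a b => simp [M.tensorFunctional_tmul]
        | add u v hu hv =>
          simp only [map_add, smul_eq_mul] at *; linear_combination hu + hv) }
    (‖D‖ * ‖M.right‖ * C) fun x => le_of_tendsto (hφ x).norm (Eventually.of_forall (hbound x))
  have hinner : ∀ a x, φ' (M.right a x) - φ' (M.left a x) = D a (M.right 1 x) := by
    intro a x
    refine tendsto_nhds_unique ((hφ (M.right a x)).sub (hφ (M.left a x))) ?_
    simp only [M.tensorFunctional_right_sub_left hD]
    rw [← zero_add (D a (M.right 1 x))]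
    refine Tendsto.add ?_ ?_
    · refine squeeze_zero_norm (fun i => M.norm_tensorFunctional_le D x _) ?_
      have := ((hcomm a).mono_left hU).const_mul (‖D‖ * ‖M.right‖ * ‖x‖)
      rwa [mul_zero] at this
    · have hc : Continuous fun b => D a (M.right b x) := by fun_prop
      exact (hc.tendsto 1).comp (hone'.mono_left hU)
  -- The bimodule need not be unital: `φ'` only implements x ↦ D a (x · 1). The missing part of D a
  -- x is D 1 (a · x), which the correction term supplies.
  refine ⟨φ' - (D 1).comp (M.left 1), fun a x => ?_⟩
  have e1 := hD 1 a x
  -- On vectors z = 1 · z = z · 1 the derivation rule for 1 = 1 · 1 reads D 1 z = 2 D 1 z.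
  have e2 : D 1 (M.left 1 (M.right a x)) = 0 := by
    have := hD 1 1 (M.left 1 (M.right a x))
    rw [← M.left_right, ← M.right_mul, ← M.left_mul, mul_one, mul_one] at this
    simpa using this
  have e3 : M.left 1 (M.left a x) = M.left a x := by rw [← M.left_mul, one_mul]
  have e4 := hinner a x
  rw [one_mul] at e1
  simp only [sub_apply, ContinuousLinearMap.comp_apply, e2, e3]
  linear_combination e1 - e4

end Johnson

/-! ### Luzin families: construction, non-separation, countable separation. -/

section LuzinFamily

open Set

/-- Given countably many infinite almost disjoint sets `G k` and sets `H k` almost disjoint from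
them, there are disjoint infinite sets, almost disjoint from all of these, the first of which
meets every `G k`. -/
theorem exists_disjoint_almostDisjoint (G H : ℕ → Set ℕ) (hG : ∀ k, (G k).Infinite)
    (hGG : ∀ k l, k ≠ l → (G k ∩ G l).Finite) (hGH : ∀ k l, (G k ∩ H l).Finite) :
    ∃ E F : Set ℕ, Disjoint E F ∧ F.Infinite ∧ (∀ k, (E ∩ G k).Nonempty) ∧
      ∀ k, (E ∩ G k).Finite ∧ (E ∩ H k).Finite ∧ (F ∩ G k).Finite ∧ (F ∩ H k).Finite := by
  have hinf : ∀ m : ℕ, (G m \ ⋃ k ∈ Finset.range m, (G k ∪ H k)).Infinite := by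
    intro m
    have hfin : (G m ∩ ⋃ k ∈ Finset.range m, (G k ∪ H k)).Finite := by
      simp only [inter_iUnion]
      refine (Finset.range m).finite_toSet.biUnion fun k hk => ?_
      rw [inter_union_distrib_left]
      refine (hGG m k ?_).union (hGH m k)
      have := Finset.mem_range.1 (Finset.mem_coe.1 hk)
      omega
    have := (hG m).sdiff hfin
    rwa [sdiff_self_inter] at this
  choose next hnext hlt using fun (m n : ℕ) => (hinf m).exists_gt n
  -- Each G k supplies two consecutive points, `z (2 * k)` for E and `z (2 * k + 1)` for F, both
  -- outside all earlier G and H. So G k and H k contain only points z n with n < 2(k + 1).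
  obtain ⟨z, hz, hmono⟩ : ∃ z : ℕ → ℕ,
      (∀ n, z n ∈ G (n / 2) \ ⋃ k ∈ Finset.range (n / 2), (G k ∪ H k)) ∧ StrictMono z := by
    let z : ℕ → ℕ := fun n => Nat.rec (next 0 0) (fun k y => next ((k + 1) / 2) y) n
    refine ⟨z, fun n => ?_, strictMono_nat_of_lt_succ fun n => hlt ((n + 1) / 2) (z n)⟩
    cases n with
    | zero => exact hnext 0 0
    | succ k => exact hnext ((k + 1) / 2) (z k)
  have hzfin : ∀ k n, z n ∈ G k ∪ H k → n < 2 * (k + 1) := by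
    intro k n h
    by_contra hn
    refine (hz n).2 (mem_iUnion₂.2 ⟨k, ?_, h⟩)
    rw [Finset.mem_range]
    omega
  have hfin : ∀ (f : ℕ → ℕ) (k : ℕ) (Y : Set ℕ), Y ⊆ G k ∪ H k →
      (range (fun n => z (f n)) ∩ Y).Finite := by
    intro f k Y hY
    refine ((Finset.range (2 * (k + 1))).finite_toSet.image z).subset ?_
    rintro _ ⟨⟨n, rfl⟩, h⟩
    exact ⟨f n, by simpa using hzfin k (f n) (hY h), rfl⟩
  refine ⟨range fun n => z (2 * n), range fun n => z (2 * n + 1), ?_, ?_, fun k => ?_, fun k => ?_⟩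
  · rw [Set.disjoint_left]
    rintro _ ⟨n, rfl⟩ ⟨m, hm⟩
    have := hmono.injective hm
    omega
  · refine infinite_range_of_injective fun m n h => ?_
    have := hmono.injective h
    omega
  · refine ⟨z (2 * k), ⟨k, rfl⟩, ?_⟩
    have := (hz (2 * k)).1
    rwa [Nat.mul_div_cancel_left k two_pos] at this
  · exact ⟨hfin (fun n => 2 * n) k _ subset_union_left, hfin (fun n => 2 * n) k _ subset_union_right,
      hfin (fun n => 2 * n + 1) k _ subset_union_left,
      hfin (fun n => 2 * n + 1) k _ subset_union_right⟩

/-- Two pairs of sets are in Luzin position: all intersections across the pairs are finite, but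
the first set of one of the pairs meets the second set of the other. -/
def LuzinRel (P Q : Set ℕ × Set ℕ) : Prop :=
  (P.1 ∩ Q.1).Finite ∧ (P.1 ∩ Q.2).Finite ∧ (P.2 ∩ Q.1).Finite ∧ (P.2 ∩ Q.2).Finite ∧
    (P.1 ∩ Q.2 ∪ P.2 ∩ Q.1).Nonempty

theorem LuzinRel.symm {P Q : Set ℕ × Set ℕ} (h : LuzinRel P Q) : LuzinRel Q P := by
  obtain ⟨h1, h2, h3, h4, h5⟩ := h
  refine ⟨?_, ?_, ?_, ?_, ?_⟩
  · rwa [inter_comm]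
  · rwa [inter_comm]
  · rwa [inter_comm]
  · rwa [inter_comm]
  · rwa [inter_comm Q.1, inter_comm Q.2, union_comm]

/-- There is an uncountable family of pairs of disjoint sets in pairwise Luzin position. -/
theorem exists_uncountable_luzin :
    ∃ S : Set (Set ℕ × Set ℕ), ¬ S.Countable ∧ (∀ P ∈ S, Disjoint P.1 P.2) ∧
      S.Pairwise LuzinRel := by
  let col : ℕ → Set ℕ := fun k => {x | x.unpair.1 = k}
  have hcol : ∀ k, (col k).Infinite := fun k =>
    infinite_of_injective_forall_mem (f := fun n => Nat.pair k n)
      (fun m n h => (Nat.pair_eq_pair.1 h).2) (by simp [col])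
  have hcolcol : ∀ k l, k ≠ l → (col k ∩ col l).Finite := fun k l hkl => by
    have : col k ∩ col l = ∅ := by
      ext x
      simp only [col, mem_inter_iff, mem_ofPred_eq, mem_empty_iff_false, iff_false]
      rintro ⟨rfl, rfl⟩
      exact hkl rfl
    simp [this]
  -- The columns make the list of sets to diagonalize against infinite even when the maximal family
  -- is finite. Infinitude of `P.2` gives the final contradiction.
  let good : Set ℕ × Set ℕ → Prop := fun P =>
    Disjoint P.1 P.2 ∧ P.2.Infinite ∧ ∀ k, (P.1 ∩ col k).Finite ∧ (P.2 ∩ col k).Finite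
  obtain ⟨S, hS⟩ := zorn_subset {S : Set (Set ℕ × Set ℕ) | (∀ P ∈ S, good P) ∧ S.Pairwise LuzinRel}
    (by
      intro c hc hchain
      refine ⟨⋃₀ c, ⟨?_, ?_⟩, fun s hs => subset_sUnion_of_mem hs⟩
      · rintro P ⟨s, hs, hP⟩
        exact (hc hs).1 P hP
      · rw [pairwise_sUnion hchain.directedOn]
        exact fun s hs => (hc hs).2)
  obtain ⟨hgood, hpair⟩ := hS.prop
  refine ⟨S, fun hcount => ?_, fun P hP => (hgood P hP).1, hpair⟩
  have := hcount.to_subtype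
  obtain ⟨_⟩ := nonempty_denumerable (ℕ ⊕ S)
  let e : ℕ ≃ ℕ ⊕ S := (Denumerable.eqv (ℕ ⊕ S)).symm
  let g : ℕ ⊕ S → Set ℕ := Sum.elim col fun P => P.1.2
  let h : ℕ ⊕ S → Set ℕ := Sum.elim (fun _ => ∅) fun P => P.1.1
  obtain ⟨E, F, hEF, hF, hmeet, hfin⟩ := exists_disjoint_almostDisjoint (g ∘ e) (h ∘ e)
    (by
      intro k
      simp only [Function.comp_apply]
      rcases e k with n | P
      · exact hcol n
      · exact (hgood P.1 P.2).2.1)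
    (by
      intro k l hkl
      have hne : e k ≠ e l := fun h => hkl (e.injective h)
      simp only [Function.comp_apply]
      rcases hk : e k with n | P <;> rcases hl : e l with m | Q <;> rw [hk, hl] at hne
      · exact hcolcol n m fun h => hne (by rw [h])
      · rw [inter_comm]
        exact ((hgood Q.1 Q.2).2.2 n).2
      · exact ((hgood P.1 P.2).2.2 m).2
      · exact (hpair P.2 Q.2 fun h => hne (by rw [Subtype.ext h])).2.2.2.1)
    (by
      intro k l
      simp only [Function.comp_apply]
      rcases hk : e k with n | P <;> rcases hl : e l with m | Q
      · simp [h]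
      · rw [inter_comm]
        exact ((hgood Q.1 Q.2).2.2 n).1
      · simp [h]
      · by_cases hPQ : P = Q
        · subst hPQ
          have := (hgood P.1 P.2).1
          simp only [g, h, Sum.elim_inr]
          rw [inter_comm, this.inter_eq]
          exact finite_empty
        · exact (hpair P.2 Q.2 fun h => hPQ (Subtype.ext h)).2.2.1)
  have hfin' : ∀ i, (E ∩ g i).Finite ∧ (E ∩ h i).Finite ∧ (F ∩ g i).Finite ∧ (F ∩ h i).Finite := by
    intro i
    simpa using hfin (e.symm i)
  have hmeet' : ∀ i, (E ∩ g i).Nonempty := by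
    intro i
    simpa using hmeet (e.symm i)
  have hrel : ∀ P ∈ S, LuzinRel (E, F) P := fun P hP =>
    ⟨(hfin' (Sum.inr ⟨P, hP⟩)).2.1, (hfin' (Sum.inr ⟨P, hP⟩)).1,
      (hfin' (Sum.inr ⟨P, hP⟩)).2.2.2, (hfin' (Sum.inr ⟨P, hP⟩)).2.2.1,
      (hmeet' (Sum.inr ⟨P, hP⟩)).inl⟩
  have hmem : (E, F) ∈ S := by
    refine hS.le_of_ge (y := insert (E, F) S) ⟨?_, ?_⟩ (subset_insert _ _) (mem_insert _ _)
    · rintro P (rfl | hP)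
      · exact ⟨hEF, hF, fun k => ⟨(hfin' (Sum.inl k)).1, (hfin' (Sum.inl k)).2.2.1⟩⟩
      · exact hgood P hP
    · refine hpair.insert fun P hP _ => ⟨hrel P hP, (hrel P hP).symm⟩
  -- By maximality the new pair already belongs to S, hence is in Luzin position with itself, making
  -- F = F ∩ F finite.
  have := (hrel _ hmem).2.2.2.1
  rw [inter_self] at this
  exact hF this

/-- A Luzin family of pairs of sets, indexed by `I`. -/
structure IsLuzinFamily {I : Type*} (E F : I → Set ℕ) : Prop where
  disjoint : ∀ i, Disjoint (E i) (F i)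
  rel : ∀ i j, i ≠ j → LuzinRel (E i, F i) (E j, F j)

theorem exists_isLuzinFamily_of_card {I : Type} (hI : #I = ℵ₁) :
    ∃ E F : I → Set ℕ, IsLuzinFamily E F := by
  obtain ⟨S, hS, hdisj, hpair⟩ := exists_uncountable_luzin
  have hcard : #I ≤ #S := by
    rw [hI, ← Cardinal.succ_aleph0, Order.succ_le_iff]
    rw [← Cardinal.le_aleph0_iff_set_countable, not_le] at hS
    exact hS
  obtain ⟨f⟩ := hcard
  exact ⟨fun i => (f i).1.1, fun i => (f i).1.2, fun i => hdisj _ (f i).2, fun i j hij =>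
    hpair (f i).2 (f j).2 fun h => hij (f.injective (Subtype.ext h))⟩

/-- An uncountable Luzin family cannot be separated. -/
theorem IsLuzinFamily.not_separated {I : Type*} {E F : I → Set ℕ} (h : IsLuzinFamily E F)
    (hI : Uncountable I) (X : Set ℕ) (hE : ∀ i, (E i \ X).Finite) (hF : ∀ i, (F i ∩ X).Finite) :
    False := by
  have hN : ∀ i, ∃ N : ℕ, ∀ x, x ∈ E i \ X ∪ F i ∩ X → x < N := by
    intro i
    obtain ⟨N, hN⟩ := ((hE i).union (hF i)).bddAbove
    exact ⟨N + 1, fun x hx => Nat.lt_succ_of_le (hN hx)⟩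
  choose N hN using hN
  classical
  -- Two indices share a code. A point of E i ∩ F j below the common bound would lie in E j ∩ F j;
  -- above it, it would be both in X and outside X.
  let c : I → ℕ × Finset ℕ × Finset ℕ := fun i =>
    (N i, (Finset.range (N i)).filter (· ∈ E i), (Finset.range (N i)).filter (· ∈ F i))
  have hc : ¬ Function.Injective c := fun hc => by
    have := hc.countable
    exact not_countable (α := I) this
  have key : ∀ i j, c i = c j → ∀ x, x ∈ E i → x ∈ F j → False := by
    intro i j hij x hi hj
    simp only [c, Prod.mk.injEq] at hij
    obtain ⟨h1, h2, -⟩ := hij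
    by_cases hx : x < N i
    · have : x ∈ (Finset.range (N j)).filter (· ∈ E j) := by
        rw [← h2]
        simp [hx, hi]
      exact Set.disjoint_left.1 (h.disjoint j) (Finset.mem_filter.1 this).2 hj
    · have hX : x ∈ X := by
        by_contra hX
        exact hx (hN i x (Or.inl ⟨hi, hX⟩))
      exact hx (h1 ▸ hN j x (Or.inr ⟨hj, hX⟩))
  simp only [Function.Injective, not_forall] at hc
  obtain ⟨i, j, hij, hne⟩ := hc
  obtain ⟨x, hx | hx⟩ := (h.rel i j hne).2.2.2.2
  · exact key i j hij x hx.1 hx.2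
  · exact key j i hij.symm x hx.2 hx.1

/-- Every countable part of a Luzin family can be separated. -/
theorem IsLuzinFamily.exists_separation {I : Type*} {E F : I → Set ℕ} (h : IsLuzinFamily E F)
    (S : Set I) (hS : S.Countable) :
    ∃ X : Set ℕ, ∀ i ∈ S, (F i \ X).Finite ∧ (E i ∩ X).Finite := by
  have hEF : ∀ i j, (E i ∩ F j).Finite := by
    intro i j
    by_cases hij : i = j
    · subst hij
      rw [(h.disjoint i).inter_eq]
      exact finite_empty
    · exact (h.rel i j hij).2.1
  obtain rfl | hne := S.eq_empty_or_nonempty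
  · exact ⟨∅, by simp⟩
  obtain ⟨f, rfl⟩ := hS.exists_eq_range hne
  -- From F (f k) only the finitely many E (f l) with l ≤ k are removed, so F (f k) loses a finite
  -- set and E (f m) can meet only the terms with k < m.
  refine ⟨⋃ k, F (f k) \ ⋃ l ∈ Finset.range (k + 1), E (f l), ?_⟩
  rintro _ ⟨m, rfl⟩
  constructor
  · refine ((Finset.range (m + 1)).finite_toSet.biUnion fun l _ => hEF (f l) (f m)).subset ?_
    rintro x ⟨hx, hx'⟩
    by_contra hx2
    refine hx' (mem_iUnion.2 ⟨m, hx, fun hx3 => hx2 ?_⟩)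
    obtain ⟨l, hl, hx4⟩ := mem_iUnion₂.1 hx3
    exact mem_iUnion₂.2 ⟨l, hl, hx4, hx⟩
  · refine ((Finset.range m).finite_toSet.biUnion fun l _ => hEF (f m) (f l)).subset ?_
    rintro x ⟨hx, hx'⟩
    obtain ⟨k, hk, hk'⟩ := mem_iUnion.1 hx'
    refine mem_iUnion₂.2 ⟨k, ?_, hx, hk⟩
    by_contra hmk
    refine hk' (mem_iUnion₂.2 ⟨m, ?_, hx⟩)
    simp only [Finset.coe_range, mem_Iio, Finset.mem_range] at *
    omega

end LuzinFamily

/-- The algebra of complex `2 × 2` matrices. -/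
abbrev MatTwo : Type := Matrix (Fin 2) (Fin 2) ℂ

/-! ### Bounded groups of 2 × 2 matrices preserve a hermitian form. -/

section Unitarization

open scoped MatrixOrder ComplexOrder

/-- Strict concavity of the square root of the determinant on positive hermitian `2 × 2`
matrices, in real coordinates. -/
theorem eq_of_det_add_le {a d b c a' d' b' c' δ : ℝ} (hδ : 0 < δ) (ha : 0 < a) (ha' : 0 < a')
    (h : a * d - (b ^ 2 + c ^ 2) = δ) (h' : a' * d' - (b' ^ 2 + c' ^ 2) = δ)
    (hle : (a + a') * (d + d') - ((b + b') ^ 2 + (c + c') ^ 2) ≤ 4 * δ) :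
    a = a' ∧ d = d' ∧ b = b' ∧ c = c' := by
  have h1 : a * d' + a' * d - 2 * (b * b' + c * c') ≤ 2 * δ := by linarith
  have h2 : δ * (a - a') ^ 2 + (a * b' - a' * b) ^ 2 + (a * c' - a' * c) ^ 2 ≤ 0 := by
    -- Multiplying the mixed discriminant by a a' and eliminating d and d' through the determinant
    -- equations leaves a sum of squares.
    have e : δ * (a - a') ^ 2 + (a * b' - a' * b) ^ 2 + (a * c' - a' * c) ^ 2 =
        a * a' * ((a * d' + a' * d - 2 * (b * b' + c * c')) - 2 * δ) := by
      linear_combination (-a' ^ 2) * h - a ^ 2 * h'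
    rw [e]
    exact mul_nonpos_of_nonneg_of_nonpos (by positivity) (by linarith)
  have p1 : 0 ≤ δ * (a - a') ^ 2 := by positivity
  have p2 := sq_nonneg (a * b' - a' * b)
  have p3 := sq_nonneg (a * c' - a' * c)
  have haa : a = a' := by
    have : δ * (a - a') ^ 2 = 0 := by linarith
    have := (mul_eq_zero.1 this).resolve_left hδ.ne'
    exact sub_eq_zero.1 (pow_eq_zero_iff two_ne_zero |>.1 this)
  subst haa
  have hbb : b = b' := by
    have : (a * b' - a * b) ^ 2 = 0 := by linarith
    have := pow_eq_zero_iff two_ne_zero |>.1 this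
    exact (mul_left_cancel₀ ha.ne' (sub_eq_zero.1 this)).symm
  have hcc : c = c' := by
    have : (a * c' - a * c) ^ 2 = 0 := by linarith
    have := pow_eq_zero_iff two_ne_zero |>.1 this
    exact (mul_left_cancel₀ ha.ne' (sub_eq_zero.1 this)).symm
  subst hbb hcc
  refine ⟨rfl, ?_, rfl, rfl⟩
  exact mul_left_cancel₀ ha.ne' (by linarith)

theorem Matrix.IsHermitian.det_fin_two_eq {h : Matrix (Fin 2) (Fin 2) ℂ} (hh : h.IsHermitian) :
    h.det = (((h 0 0).re * (h 1 1).re - ((h 0 1).re ^ 2 + (h 0 1).im ^ 2) : ℝ) : ℂ) := by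
  have h0 := hh.apply 0 0
  have h1 := hh.apply 1 1
  have h2 := hh.apply 0 1
  rw [Matrix.det_fin_two, ← h2]
  rw [Complex.star_def, Complex.conj_eq_iff_re] at h0 h1
  rw [← h0, ← h1]
  apply Complex.ext
  · simp [pow_two]
  · simp [pow_two]
    ring

theorem Matrix.IsHermitian.eq_of_fin_two {h k : Matrix (Fin 2) (Fin 2) ℂ} (hh : h.IsHermitian)
    (hk : k.IsHermitian) (h0 : (h 0 0).re = (k 0 0).re) (h1 : (h 1 1).re = (k 1 1).re)
    (h2 : h 0 1 = k 0 1) : h = k := by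
  have a0 := hh.apply 0 0
  have a1 := hh.apply 1 1
  have b0 := hk.apply 0 0
  have b1 := hk.apply 1 1
  rw [Complex.star_def, Complex.conj_eq_iff_re] at a0 a1 b0 b1
  ext i j
  fin_cases i <;> fin_cases j
  · exact a0.symm.trans ((congrArg _ h0).trans b0)
  · exact h2
  · change h 1 0 = k 1 0
    rw [← hh.apply 1 0, ← hk.apply 1 0, h2]
  · exact a1.symm.trans ((congrArg _ h1).trans b1)

/-- A bounded group of `2 × 2` matrices preserves a hermitian form which is bounded above and
below in terms of the bound of the group. -/
theorem exists_invariant_form {G : Type*} [Group G] (ρ : G →* Matrix (Fin 2) (Fin 2) ℂ) {C : ℝ}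
    (hC : ∀ g, ‖ρ g‖ ≤ C) :
    ∃ h : Matrix (Fin 2) (Fin 2) ℂ, h.IsHermitian ∧ (∀ g, star (ρ g) * h * ρ g = h) ∧
      ‖h‖ ≤ C ^ 2 ∧ (∀ i, (C ^ 2)⁻¹ ≤ (h i i).re) ∧ 1 ≤ h.det.re := by
  have hC1 : 1 ≤ C := by simpa using hC 1
  have hC0 : 0 < C ^ 2 := by positivity
  -- A compact set, invariant under the group and under midpoints, containing 1. The invariant form
  -- is its point of maximal determinant, unique by strict concavity.
  let K : Set MatTwo := {h | ∀ g, algebraMap ℝ MatTwo (C ^ 2)⁻¹ ≤ star (ρ g) * h * ρ g ∧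
    star (ρ g) * h * ρ g ≤ algebraMap ℝ MatTwo (C ^ 2)}
  have hstar : ∀ g, star (ρ g) * ρ g ≤ algebraMap ℝ MatTwo (C ^ 2) := fun g =>
    CStarAlgebra.star_mul_le_algebraMap_norm_sq.trans
      (algebraMap_mono MatTwo (pow_le_pow_left₀ (norm_nonneg _) (hC g) 2))
  have hone : (1 : MatTwo) ∈ K := by
    intro g
    rw [mul_one]
    refine ⟨?_, hstar g⟩
    -- Conjugating the upper bound for g⁻¹ by ρ g gives 1 ≤ C² (ρ g)* ρ g.
    have h1 := star_left_conjugate_le_conjugate (hstar g⁻¹) (ρ g)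
    rw [← mul_assoc, ← star_mul, mul_assoc, ← map_mul, inv_mul_cancel, map_one, star_one, one_mul,
      ← Algebra.commutes, mul_assoc, ← Algebra.smul_def] at h1
    have h2 := smul_le_smul_of_nonneg_left h1 (inv_nonneg.2 hC0.le)
    rw [smul_smul, inv_mul_cancel₀ hC0.ne', one_smul] at h2
    rwa [Algebra.algebraMap_eq_smul_one]
  have hact : ∀ h ∈ K, ∀ g, star (ρ g) * h * ρ g ∈ K := by
    intro h hh g k
    have := hh (g * k)
    rw [map_mul, star_mul] at this
    simpa only [mul_assoc] using this
  have hmid : ∀ h ∈ K, ∀ k ∈ K, (2⁻¹ : ℝ) • (h + k) ∈ K := by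
    intro h hh k hk g
    have e : star (ρ g) * ((2⁻¹ : ℝ) • (h + k)) * ρ g =
        (2⁻¹ : ℝ) • (star (ρ g) * h * ρ g + star (ρ g) * k * ρ g) := by
      rw [mul_smul_comm, smul_mul_assoc, mul_add, add_mul]
    have e' : ∀ x : MatTwo, x = (2⁻¹ : ℝ) • (x + x) := by
      intro x
      rw [← two_smul ℝ x, smul_smul, inv_mul_cancel₀ two_ne_zero, one_smul]
    rw [e]
    constructor
    · rw [e' (algebraMap ℝ MatTwo (C ^ 2)⁻¹)]
      exact smul_le_smul_of_nonneg_left (add_le_add (hh g).1 (hk g).1) (by norm_num)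
    · rw [e' (algebraMap ℝ MatTwo (C ^ 2))]
      exact smul_le_smul_of_nonneg_left (add_le_add (hh g).2 (hk g).2) (by norm_num)
  have hself : ∀ h ∈ K, algebraMap ℝ MatTwo (C ^ 2)⁻¹ ≤ h ∧ h ≤ algebraMap ℝ MatTwo (C ^ 2) := by
    intro h hh
    simpa using hh 1
  have hpos : ∀ h ∈ K, 0 ≤ h := fun h hh =>
    (algebraMap_nonneg MatTwo (inv_nonneg.2 hC0.le)).trans (hself h hh).1
  have hherm : ∀ h ∈ K, h.IsHermitian := fun h hh => (Matrix.nonneg_iff_posSemidef.1 (hpos h hh)).1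
  have hdiag : ∀ h ∈ K, ∀ i, (C ^ 2)⁻¹ ≤ (h i i).re := by
    intro h hh i
    have := (Matrix.le_iff.1 (hself h hh).1).diag_nonneg (i := i)
    rw [Matrix.sub_apply, Matrix.algebraMap_matrix_apply, if_pos rfl] at this
    have := (Complex.le_def.1 this).1
    rw [Complex.zero_re, Complex.sub_re, Complex.coe_algebraMap, Complex.ofReal_re] at this
    linarith
  have hnorm : ∀ h ∈ K, ‖h‖ ≤ C ^ 2 := by
    intro h hh
    refine (CStarAlgebra.norm_le_norm_of_nonneg_of_le (hpos h hh) (hself h hh).2).trans ?_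
    rw [norm_algebraMap', Real.norm_of_nonneg hC0.le]
  have hclosed : IsClosed K := by
    have : K = ⋂ g, {h | algebraMap ℝ MatTwo (C ^ 2)⁻¹ ≤ star (ρ g) * h * ρ g} ∩
        {h | star (ρ g) * h * ρ g ≤ algebraMap ℝ MatTwo (C ^ 2)} := by
      ext h
      simp [K]
    rw [this]
    exact isClosed_iInter fun g => (isClosed_le continuous_const (by fun_prop)).inter
      (isClosed_le (by fun_prop) continuous_const)
  have hproper : ProperSpace MatTwo := FiniteDimensional.proper ℂ MatTwo
  have hcompact : IsCompact K := (isCompact_closedBall (0 : MatTwo) (C ^ 2)).of_isClosed_subset hclosed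
    fun h hh => by simpa using hnorm h hh
  obtain ⟨h, hh, hmax⟩ := hcompact.exists_isMaxOn ⟨1, hone⟩
    (f := fun h => (Matrix.det h).re) (by fun_prop)
  have hmax' : ∀ k ∈ K, (Matrix.det k).re ≤ (Matrix.det h).re := fun k hk => hmax hk
  have hdet1 : 1 ≤ h.det.re := by
    have := hmax' 1 hone
    rwa [Matrix.det_one, Complex.one_re] at this
  have hdet : 0 < h.det.re := one_pos.trans_le hdet1
  have hdetact : ∀ g, (star (ρ g) * h * ρ g).det.re = Complex.normSq (ρ g).det * h.det.re := by
    intro g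
    have e : (star (ρ g) * h * ρ g).det = (Complex.normSq (ρ g).det : ℂ) * h.det := by
      rw [Matrix.det_mul, Matrix.det_mul, Matrix.star_eq_conjTranspose, Matrix.det_conjTranspose,
        Complex.normSq_eq_conj_mul_self, Complex.star_def]
      ring
    rw [e, Complex.re_ofReal_mul]
  have hle1 : ∀ g, Complex.normSq (ρ g).det ≤ 1 := by
    intro g
    have := hmax' _ (hact h hh g)
    rw [hdetact] at this
    nlinarith
  -- Maximality bounds |det ρ g| by 1 for both g and g⁻¹, so the action preserves determinants and
  -- moves the maximizer to a maximizer.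
  have heq1 : ∀ g, Complex.normSq (ρ g).det = 1 := by
    intro g
    have e : Complex.normSq (ρ g).det * Complex.normSq (ρ g⁻¹).det = 1 := by
      rw [← map_mul, ← Matrix.det_mul, ← map_mul, mul_inv_cancel, map_one, Matrix.det_one, map_one]
    have := hle1 g
    have := hle1 g⁻¹
    have := Complex.normSq_nonneg (ρ g).det
    nlinarith
  refine ⟨h, hherm h hh, fun g => ?_, hnorm h hh, hdiag h hh, hdet1⟩
  have hk := hact h hh g
  have hkdet := hdetact g
  rw [heq1, one_mul] at hkdet
  set k := star (ρ g) * h * ρ g with hkdef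
  have hhk := hmax' _ (hmid h hh k hk)
  have hsum : (h + k).IsHermitian := (hherm h hh).add (hherm k hk)
  have hsmul : ((2⁻¹ : ℝ) • (h + k)).det.re = 4⁻¹ * (h + k).det.re := by
    have : (2⁻¹ : ℝ) • (h + k) = (2⁻¹ : ℂ) • (h + k) := by
      ext i j
      simp [mul_add]
    rw [this, Matrix.det_smul, Fintype.card_fin]
    have : ((2⁻¹ : ℂ) ^ 2) = ((4⁻¹ : ℝ) : ℂ) := by norm_num
    rw [this, Complex.re_ofReal_mul]
  rw [hsmul, hsum.det_fin_two_eq, Complex.ofReal_re] at hhk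
  have e1 := hkdet
  rw [(hherm k hk).det_fin_two_eq, Complex.ofReal_re] at e1
  have e2 : h.det.re = h.det.re := rfl
  conv_lhs at e2 => rw [(hherm h hh).det_fin_two_eq, Complex.ofReal_re]
  have hp : 0 < (C ^ 2)⁻¹ := inv_pos.2 hC0
  simp only [Matrix.add_apply, Complex.add_re, Complex.add_im] at hhk
  obtain ⟨r1, r2, r3, r4⟩ := eq_of_det_add_le hdet (hp.trans_le (hdiag h hh 0))
    (hp.trans_le (hdiag k hk 0)) e2 e1 (by linarith)
  exact ((hherm h hh).eq_of_fin_two (hherm k hk) r1 r2 (Complex.ext r3 r4)).symm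

end Unitarization

/-! ### Sequences of matrices, null sequences and commutation modulo them. -/

section Sequences

open scoped Classical in
/-- The sequence which is `x` on `S` and `0` elsewhere. -/
def blockSeq (S : Set ℕ) (x : MatTwo) : EllInftyM2 :=
  ⟨fun n => if n ∈ S then x else 0, memℓp_infty ⟨‖x‖, by
    rintro _ ⟨n, rfl⟩
    dsimp only
    split_ifs <;> simp⟩⟩

theorem blockSeq_apply_of_mem {S : Set ℕ} {n : ℕ} (h : n ∈ S) (x : MatTwo) :
    blockSeq S x n = x := if_pos h

theorem blockSeq_apply_of_notMem {S : Set ℕ} {n : ℕ} (h : n ∉ S) (x : MatTwo) :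
    blockSeq S x n = 0 := if_neg h

theorem EllInftyM2.ext {x y : EllInftyM2} (h : ∀ n, x n = y n) : x = y :=
  lp.ext (funext h)

theorem EllInftyM2.mul_apply (x y : EllInftyM2) (n : ℕ) : (x * y) n = x n * y n := rfl

theorem EllInftyM2.one_apply (n : ℕ) : (1 : EllInftyM2) n = 1 := rfl

theorem EllInftyM2.add_apply (x y : EllInftyM2) (n : ℕ) : (x + y) n = x n + y n := rfl

theorem EllInftyM2.sub_apply (x y : EllInftyM2) (n : ℕ) : (x - y) n = x n - y n := rfl

theorem EllInftyM2.smul_apply (c : ℂ) (x : EllInftyM2) (n : ℕ) : (c • x) n = c • x n := rfl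

theorem EllInftyM2.sum_apply {κ : Type*} (s : Finset κ) (f : κ → EllInftyM2) (n : ℕ) :
    (∑ i ∈ s, f i) n = ∑ i ∈ s, f i n := by
  rw [lp.coeFn_sum, Finset.sum_apply]

theorem EllInftyM2.norm_apply_le (x : EllInftyM2) (n : ℕ) : ‖x n‖ ≤ ‖x‖ :=
  lp.norm_apply_le_norm ENNReal.top_ne_zero x n

/-- Evaluation of a sequence at `n`, as an algebra homomorphism. -/
def evalAlgHom (n : ℕ) : EllInftyM2 →ₐ[ℂ] MatTwo where
  toFun x := x n
  map_one' := rfl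
  map_mul' _ _ := rfl
  map_zero' := rfl
  map_add' _ _ := rfl
  commutes' _ := rfl

/-- A uniformly bounded sequence of representations of a monoid on `ℂ²` gives a representation
in `ℓ∞(ℕ, M₂)`. -/
def boundedSeqHom {G : Type*} [Monoid G] (ρ : ℕ → G →* MatTwo) (C : ℝ)
    (h : ∀ n g, ‖ρ n g‖ ≤ C) : G →* EllInftyM2 where
  toFun g := ⟨fun n => ρ n g, memℓp_infty ⟨C, by rintro _ ⟨n, rfl⟩; exact h n g⟩⟩
  map_one' := EllInftyM2.ext fun n => (ρ n).map_one
  map_mul' g k := EllInftyM2.ext fun n => (ρ n).map_mul g k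

theorem boundedSeqHom_apply {G : Type*} [Monoid G] (ρ : ℕ → G →* MatTwo) (C : ℝ)
    (h : ∀ n g, ‖ρ n g‖ ≤ C) (g : G) (n : ℕ) : boundedSeqHom ρ C h g n = ρ n g := rfl

theorem norm_boundedSeqHom_le {G : Type*} [Monoid G] (ρ : ℕ → G →* MatTwo) (C : ℝ)
    (h : ∀ n g, ‖ρ n g‖ ≤ C) (g : G) : ‖boundedSeqHom ρ C h g‖ ≤ C :=
  lp.norm_le_of_forall_le' C fun n => h n g

/-- A subalgebra containing the matrix units at `n` contains all sequences supported at `n`. -/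
theorem single_mem_of_matrixUnits {D : Subalgebra ℂ EllInftyM2} {n : ℕ}
    (h : ∀ a b, lp.single ∞ n (Matrix.single a b (1 : ℂ)) ∈ D) (x : MatTwo) :
    (lp.single ∞ n x : EllInftyM2) ∈ D := by
  have e : (lp.single ∞ n x : EllInftyM2) =
      ∑ a, ∑ b, x a b • lp.single ∞ n (Matrix.single a b (1 : ℂ)) := by
    change lp.lsingle (𝕜 := ℂ) (E := fun _ : ℕ => MatTwo) ∞ n x =
      ∑ a, ∑ b, _ • lp.lsingle (𝕜 := ℂ) (E := fun _ : ℕ => MatTwo) ∞ n _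
    simp only [← map_smul, ← map_sum, Matrix.smul_single, smul_eq_mul, mul_one]
    rw [← Matrix.matrix_eq_sum_single x]
  rw [e]
  exact sum_mem fun a _ => sum_mem fun b _ => D.smul_mem (h a b) _

theorem eq_sum_single {N : ℕ} {x : EllInftyM2} (hx : ∀ n, N ≤ n → x n = 0) :
    x = ∑ n ∈ Finset.range N, lp.single ∞ n (x n) := by
  refine EllInftyM2.ext fun n => ?_
  rw [EllInftyM2.sum_apply]
  by_cases hn : n < N
  · rw [Finset.sum_eq_single n]
    · rw [lp.single_apply_self]
    · intro k _ hk
      rw [lp.single_apply_ne _ _ _ hk.symm]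
    · intro h
      exact absurd (Finset.mem_range.2 hn) h
  · rw [hx n (not_lt.1 hn), Finset.sum_eq_zero]
    intro k hk
    rw [lp.single_apply_ne]
    rintro rfl
    exact hn (Finset.mem_range.1 hk)

theorem mem_of_single_mem {D : Subalgebra ℂ EllInftyM2} {N : ℕ}
    (h : ∀ n < N, ∀ y : MatTwo, (lp.single ∞ n y : EllInftyM2) ∈ D) {x : EllInftyM2}
    (hx : ∀ n, N ≤ n → x n = 0) : x ∈ D := by
  rw [eq_sum_single hx]
  exact sum_mem fun n hn => h n (Finset.mem_range.1 hn) _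

/-- The ideal of sequences converging to zero. -/
def nullSeq : Submodule ℂ EllInftyM2 where
  carrier := {x | Tendsto (fun n => x n) atTop (𝓝 0)}
  add_mem' {x y} hx hy := by
    have := Tendsto.add (M := MatTwo) hx hy
    rwa [add_zero] at this
  zero_mem' := tendsto_const_nhds
  smul_mem' c x hx := by
    have := Tendsto.const_smul (α := MatTwo) hx c
    rwa [smul_zero] at this

theorem mem_nullSeq {x : EllInftyM2} : x ∈ nullSeq ↔ Tendsto (fun n => x n) atTop (𝓝 0) := Iff.rfl

theorem mem_nullSeq_of_eventually {x : EllInftyM2} (h : ∀ᶠ n in atTop, x n = 0) : x ∈ nullSeq :=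
  tendsto_const_nhds.congr' (h.mono fun _ h => h.symm)

theorem isClosed_nullSeq : IsClosed (nullSeq : Set EllInftyM2) := by
  refine isClosed_of_closure_subset fun x hx => ?_
  rw [SetLike.mem_coe, mem_nullSeq, Metric.tendsto_nhds]
  intro δ hδ
  obtain ⟨y, hy, hxy⟩ := Metric.mem_closure_iff.1 hx (δ / 2) (half_pos hδ)
  filter_upwards [Metric.tendsto_nhds.1 (mem_nullSeq.1 hy) (δ / 2) (half_pos hδ)] with n hn
  rw [dist_zero_right] at hn ⊢
  rw [dist_eq_norm] at hxy
  calc ‖x n‖ = ‖(x - y) n + y n‖ := by rw [EllInftyM2.sub_apply, sub_add_cancel]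
    _ ≤ ‖(x - y) n‖ + ‖y n‖ := norm_add_le _ _
    _ < δ / 2 + δ / 2 := add_lt_add_of_le_of_lt
        ((EllInftyM2.norm_apply_le _ n).trans hxy.le) hn
    _ = δ := add_halves δ

theorem mul_mem_nullSeq_left (y : EllInftyM2) {x : EllInftyM2} (hx : x ∈ nullSeq) :
    y * x ∈ nullSeq := by
  rw [mem_nullSeq] at *
  refine squeeze_zero_norm (a := fun n => ‖y‖ * ‖x n‖) (fun n => ?_) ?_
  · refine (norm_mul_le (y n) (x n)).trans ?_
    gcongr
    exact EllInftyM2.norm_apply_le y n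
  · simpa using (hx.norm).const_mul ‖y‖

theorem mul_mem_nullSeq_right (y : EllInftyM2) {x : EllInftyM2} (hx : x ∈ nullSeq) :
    x * y ∈ nullSeq := by
  rw [mem_nullSeq] at *
  refine squeeze_zero_norm (a := fun n => ‖x n‖ * ‖y‖) (fun n => ?_) ?_
  · refine (norm_mul_le (x n) (y n)).trans ?_
    gcongr
    exact EllInftyM2.norm_apply_le y n
  · simpa using (hx.norm).mul_const ‖y‖

/-- The sequences commuting with all elements of a set modulo null sequences. -/
def asymptoticCommutant (S : Set EllInftyM2) : Subalgebra ℂ EllInftyM2 where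
  carrier := {x | ∀ y ∈ S, x * y - y * x ∈ nullSeq}
  mul_mem' {x x'} hx hx' y hy := by
    have e : x * x' * y - y * (x * x') = x * (x' * y - y * x') + (x * y - y * x) * x' := by
      simp only [mul_sub, sub_mul, mul_assoc]
      abel
    rw [e]
    exact add_mem (mul_mem_nullSeq_left _ (hx' y hy)) (mul_mem_nullSeq_right _ (hx y hy))
  add_mem' {x x'} hx hx' y hy := by
    have e : (x + x') * y - y * (x + x') = (x * y - y * x) + (x' * y - y * x') := by
      rw [add_mul, mul_add]
      abel
    rw [e]
    exact add_mem (hx y hy) (hx' y hy)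
  algebraMap_mem' c y _ := by
    rw [Algebra.commutes, sub_self]
    exact zero_mem _

theorem isClosed_asymptoticCommutant (S : Set EllInftyM2) :
    IsClosed (asymptoticCommutant S : Set EllInftyM2) := by
  have : (asymptoticCommutant S : Set EllInftyM2) =
      ⋂ y ∈ S, (fun x => x * y - y * x) ⁻¹' (nullSeq : Set EllInftyM2) := by
    ext x
    simp [asymptoticCommutant]
  rw [this]
  exact isClosed_biInter fun y _ => isClosed_nullSeq.preimage (by fun_prop)

theorem mem_asymptoticCommutant_comm {S S' : Set EllInftyM2} :
    S ⊆ asymptoticCommutant S' ↔ S' ⊆ asymptoticCommutant S := by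
  constructor <;>
  · intro h x hx y hy
    rw [← neg_sub]
    exact neg_mem (h hy x hx)

/-- Closed algebras generated by sets commuting modulo null sequences commute modulo null
sequences. -/
theorem topologicalClosure_adjoin_subset_asymptoticCommutant {S : Set EllInftyM2}
    (h : S ⊆ asymptoticCommutant S) :
    ((Algebra.adjoin ℂ S).topologicalClosure : Set EllInftyM2) ⊆
      asymptoticCommutant (Algebra.adjoin ℂ S).topologicalClosure := by
  have key : ∀ S', S ⊆ asymptoticCommutant S' →
      ((Algebra.adjoin ℂ S).topologicalClosure : Set EllInftyM2) ⊆ asymptoticCommutant S' :=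
    fun S' hS' => Subalgebra.topologicalClosure_minimal (Algebra.adjoin_le hS')
      (isClosed_asymptoticCommutant S')
  -- The relation is symmetric, so `key` is used twice, once on each side.
  exact key _ (mem_asymptoticCommutant_comm.1 (key _ h))

end Sequences

/-! ### The algebras generated by null sequences and constant blocks. -/

section BlockAlgebra

variable {J : Type*}

/-- The matrix units in single coordinates, together with the sequences that are constant `P j`
on `L j` and vanish elsewhere, for `j ∈ S`. -/
def blockGenerators (L : J → Set ℕ) (P : J → MatTwo) (S : Set J) : Set EllInftyM2 :=
  (Set.range fun x : ℕ × Fin 2 × Fin 2 => lp.single ∞ x.1 (Matrix.single x.2.1 x.2.2 (1 : ℂ))) ∪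
    (fun j => blockSeq (L j) (P j)) '' S

/-- The closed unital algebra generated by the null sequences and the sequences that are constant
`P j` on `L j` and vanish elsewhere, for `j ∈ S`. -/
def blockAlgebra (L : J → Set ℕ) (P : J → MatTwo) (S : Set J) : Subalgebra ℂ EllInftyM2 :=
  (Algebra.adjoin ℂ (blockGenerators L P S)).topologicalClosure

variable {L : J → Set ℕ} {P : J → MatTwo} {S : Set J}

theorem blockGenerators_subset_blockAlgebra :
    blockGenerators L P S ⊆ blockAlgebra L P S := fun _ hx =>
  Subalgebra.le_topologicalClosure _ (Algebra.subset_adjoin hx)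

theorem isClosed_blockAlgebra : IsClosed (blockAlgebra L P S : Set EllInftyM2) :=
  Subalgebra.isClosed_topologicalClosure _

theorem blockSeq_mem_blockAlgebra {j : J} (hj : j ∈ S) :
    blockSeq (L j) (P j) ∈ blockAlgebra L P S :=
  blockGenerators_subset_blockAlgebra (Or.inr ⟨j, hj, rfl⟩)

theorem mem_blockAlgebra_of_support {N : ℕ} {x : EllInftyM2} (hx : ∀ n, N ≤ n → x n = 0) :
    x ∈ blockAlgebra L P S :=
  mem_of_single_mem (N := N) (fun n _ => single_mem_of_matrixUnits fun a b =>
    blockGenerators_subset_blockAlgebra (Or.inl ⟨(n, a, b), rfl⟩)) hx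

theorem blockAlgebra_mono {S S' : Set J} (h : S ⊆ S') :
    blockAlgebra L P S ≤ blockAlgebra L P S' :=
  Subalgebra.topologicalClosure_mono
    (Algebra.adjoin_mono (Set.union_subset_union_right _ (Set.image_mono h)))

/-- The generated algebra is the span of the monoid generated by countably many elements, and that
monoid is countable. -/
theorem isSeparable_blockAlgebra (hS : S.Countable) :
    TopologicalSpace.IsSeparable (blockAlgebra L P S : Set EllInftyM2) := by
  have hcount : (blockGenerators L P S).Countable :=
    (Set.countable_range _).union (hS.image _)
  have hmon : (Submonoid.closure (blockGenerators L P S) : Set EllInftyM2).Countable := by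
    have := hcount.to_subtype
    have : Countable (FreeMonoid (blockGenerators L P S)) :=
      inferInstanceAs (Countable (List (blockGenerators L P S)))
    rw [Submonoid.closure_eq_mrange]
    exact Set.countable_range _
  have := (hmon.isSeparable.span (R := ℂ)).closure
  rwa [← Algebra.adjoin_eq_span] at this

/-- The block algebra of an almost disjoint family is commutative modulo null sequences. -/
theorem blockAlgebra_subset_asymptoticCommutant
    (hL : ∀ i ∈ S, ∀ j ∈ S, i ≠ j → (L i ∩ L j).Finite) :
    (blockAlgebra L P S : Set EllInftyM2) ⊆ asymptoticCommutant (blockAlgebra L P S) := by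
  apply topologicalClosure_adjoin_subset_asymptoticCommutant
  have hsingle : ∀ x : EllInftyM2, ∀ n : ℕ, ∀ y : MatTwo,
      lp.single ∞ n y * x - x * lp.single ∞ n y ∈ nullSeq := by
    intro x n y
    refine mem_nullSeq_of_eventually ?_
    filter_upwards [eventually_gt_atTop n] with k hk
    rw [EllInftyM2.sub_apply, EllInftyM2.mul_apply, EllInftyM2.mul_apply,
      lp.single_apply_ne _ _ _ hk.ne', zero_mul, mul_zero, sub_self]
  rintro x (⟨z, rfl⟩ | ⟨i, hi, rfl⟩) y hy
  · exact hsingle _ _ _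
  obtain ⟨z, rfl⟩ | ⟨j, hj, rfl⟩ := hy
  · rw [← neg_sub]
    exact neg_mem (hsingle _ _ _)
  dsimp only
  by_cases hij : i = j
  · subst hij
    rw [sub_self]
    exact zero_mem _
  obtain ⟨N, hN⟩ := (hL i hi j hj hij).bddAbove
  refine mem_nullSeq_of_eventually ?_
  filter_upwards [eventually_gt_atTop N] with n hn
  rw [EllInftyM2.sub_apply, EllInftyM2.mul_apply, EllInftyM2.mul_apply]
  by_cases h1 : n ∈ L i
  · have h2 : n ∉ L j := fun h2 => absurd (hN ⟨h1, h2⟩) (not_le.2 hn)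
    rw [blockSeq_apply_of_notMem h2, mul_zero, zero_mul, sub_self]
  · rw [blockSeq_apply_of_notMem h1, mul_zero, zero_mul, sub_self]

/-- Conjugation of block algebras. -/
theorem conj_mem_blockAlgebra {P' : J → MatTwo} (u : EllInftyM2ˣ)
    (h : ∀ j ∈ S, ∃ N : ℕ, ∀ n ∈ L j, N ≤ n →
      (u : EllInftyM2) n * P j * (↑u⁻¹ : EllInftyM2) n = P' j)
    {x : EllInftyM2} (hx : x ∈ blockAlgebra L P S) :
    (u : EllInftyM2) * x * (↑u⁻¹ : EllInftyM2) ∈ blockAlgebra L P' S := by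
  let conj : EllInftyM2 →ₐ[ℂ] EllInftyM2 := AlgHom.ofLinearMap
    (LinearMap.mulRight ℂ (↑u⁻¹ : EllInftyM2) ∘ₗ LinearMap.mulLeft ℂ (u : EllInftyM2))
    (by simp) (fun x y => by simp [mul_assoc])
  have hconj : ∀ x, conj x = (u : EllInftyM2) * x * (↑u⁻¹ : EllInftyM2) := fun x => rfl
  have hle : blockAlgebra L P S ≤ (blockAlgebra L P' S).comap conj := by
    refine Subalgebra.topologicalClosure_minimal (Algebra.adjoin_le ?_)
      (isClosed_blockAlgebra.preimage (f := conj) ?_)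
    · rintro x (⟨⟨n, a, b⟩, rfl⟩ | ⟨j, hj, rfl⟩)
      · refine mem_blockAlgebra_of_support (N := n + 1) fun k hk => ?_
        change _ * (lp.single ∞ n (Matrix.single a b (1 : ℂ)) : EllInftyM2) k * _ = 0
        rw [lp.single_apply_ne _ _ _ (by omega), mul_zero, zero_mul]
      · obtain ⟨N, hN⟩ := h j hj
        change conj (blockSeq (L j) (P j)) ∈ blockAlgebra L P' S
        -- The conjugated generator differs from the new one only in finitely many coordinates.
        rw [← sub_add_cancel (conj (blockSeq (L j) (P j))) (blockSeq (L j) (P' j))]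
        refine add_mem (mem_blockAlgebra_of_support (N := N) fun n hn => ?_)
          (blockSeq_mem_blockAlgebra hj)
        rw [EllInftyM2.sub_apply, hconj, EllInftyM2.mul_apply, EllInftyM2.mul_apply]
        by_cases hnj : n ∈ L j
        · rw [blockSeq_apply_of_mem hnj, blockSeq_apply_of_mem hnj, hN n hnj hn, sub_self]
        · rw [blockSeq_apply_of_notMem hnj, blockSeq_apply_of_notMem hnj, mul_zero, zero_mul,
            sub_self]
    · change Continuous fun x => (u : EllInftyM2) * x * (↑u⁻¹ : EllInftyM2)
      fun_prop
  exact hle hx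

/-- The block algebra of self-adjoint matrices is self-adjoint. -/
theorem star_mem_blockAlgebra (hP : ∀ j ∈ S, star (P j) = P j) {x : EllInftyM2}
    (hx : x ∈ blockAlgebra L P S) : star x ∈ blockAlgebra L P S := by
  have hle : blockAlgebra L P S ≤ star (blockAlgebra L P S) := by
    refine Subalgebra.topologicalClosure_minimal (Algebra.adjoin_le ?_)
      (isClosed_blockAlgebra.preimage (f := star) continuous_star)
    rintro x (⟨⟨n, a, b⟩, rfl⟩ | ⟨j, hj, rfl⟩)
    · refine mem_blockAlgebra_of_support (N := n + 1) fun k hk => ?_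
      change star ((lp.single ∞ n (Matrix.single a b (1 : ℂ)) : EllInftyM2) k) = 0
      rw [lp.single_apply_ne _ _ _ (by omega), star_zero]
    · have : star (blockSeq (L j) (P j)) = blockSeq (L j) (P j) := by
        refine EllInftyM2.ext fun n => ?_
        rw [lp.star_apply]
        by_cases hnj : n ∈ L j
        · rw [blockSeq_apply_of_mem hnj, hP j hj]
        · rw [blockSeq_apply_of_notMem hnj, star_zero]
      change star (blockSeq (L j) (P j)) ∈ blockAlgebra L P S
      rw [this]
      exact blockSeq_mem_blockAlgebra hj
  exact hle hx

/-- A block algebra is the closure of the union of a directed family of block subalgebras. -/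
theorem closure_iUnion_blockAlgebra {κ : Type*} [Nonempty κ] {T : κ → Set J}
    (hT : Directed (· ⊆ ·) T) :
    closure (⋃ i, (blockAlgebra L P (T i) : Set EllInftyM2)) =
      (blockAlgebra L P (⋃ i, T i) : Set EllInftyM2) := by
  have hdir : Directed (· ≤ ·) fun i => blockAlgebra L P (T i) := fun i j =>
    (hT i j).imp fun k hk => ⟨blockAlgebra_mono hk.1, blockAlgebra_mono hk.2⟩
  refine Set.Subset.antisymm (closure_minimal (Set.iUnion_subset fun i =>
    blockAlgebra_mono (Set.subset_iUnion T i)) isClosed_blockAlgebra) ?_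
  rw [← Subalgebra.coe_iSup_of_directed hdir]
  refine closure_mono ?_
  refine Algebra.adjoin_le ?_
  rintro x (hx | ⟨j, hj, rfl⟩)
  · exact le_iSup (fun i => blockAlgebra L P (T i)) (Classical.arbitrary κ)
      (blockGenerators_subset_blockAlgebra (Or.inl hx))
  · obtain ⟨i, hi⟩ := Set.mem_iUnion.1 hj
    exact le_iSup (fun i => blockAlgebra L P (T i)) i (blockSeq_mem_blockAlgebra hi)

end BlockAlgebra

/-! ### Finite groups inside block algebras, and amenability. -/

section BlockAmenability

/-- The group of integral orthogonal `2 × 2` matrices. -/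
abbrev SignedPerm : Type := Matrix.unitaryGroup (Fin 2) ℤ

/-- The squares of the integers in a row add up to 1, so all entries lie in {-1, 0, 1}. -/
instance : Finite SignedPerm := by
  have hbound : ∀ (u : SignedPerm) (i j : Fin 2), (u : Matrix (Fin 2) (Fin 2) ℤ) i j ∈
      Set.Icc (-1 : ℤ) 1 := by
    intro u i j
    have h := congrFun (congrFun (Matrix.mem_unitaryGroup_iff.1 u.2) i) i
    rw [Matrix.mul_apply, Fin.sum_univ_two, Matrix.one_apply_eq] at h
    simp only [Matrix.star_apply, star_trivial] at h
    rw [Set.mem_Icc]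
    have key : (u : Matrix (Fin 2) (Fin 2) ℤ) i j * (u : Matrix (Fin 2) (Fin 2) ℤ) i j ≤ 1 := by
      have h0 := mul_self_nonneg ((u : Matrix (Fin 2) (Fin 2) ℤ) i 0)
      have h1 := mul_self_nonneg ((u : Matrix (Fin 2) (Fin 2) ℤ) i 1)
      have hj : j = 0 ∨ j = 1 := by
        fin_cases j <;> simp
      rcases hj with rfl | rfl <;> linarith
    constructor <;> nlinarith
  refine Finite.of_injective
    (fun (u : SignedPerm) (i j : Fin 2) => (⟨_, hbound u i j⟩ : Set.Icc (-1 : ℤ) 1)) ?_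
  intro u v huv
  ext i j
  exact congrArg Subtype.val (congrFun (congrFun huv i) j)

/-- Integral orthogonal matrices as complex matrices. -/
def signedPermHom : SignedPerm →* MatTwo :=
  ((Int.castRingHom ℂ).mapMatrix (m := Fin 2)).toMonoidHom.comp
    (Matrix.unitaryGroup (Fin 2) ℤ).subtype

theorem norm_signedPermHom (u : SignedPerm) : ‖signedPermHom u‖ ≤ 1 := by
  refine (CStarRing.norm_of_mem_unitary (E := MatTwo) ?_).le
  have hstar : star (signedPermHom u) = signedPermHom (star u) := by
    ext i j
    simp [signedPermHom]
  rw [Unitary.mem_iff, hstar, ← map_mul, ← map_mul, Unitary.star_mul_self, Unitary.mul_star_self,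
    map_one]
  exact ⟨rfl, rfl⟩

/-- The reflection `diag(1, -1)`. -/
def reflectionPerm : SignedPerm :=
  ⟨!![1, 0; 0, -1], by
    rw [Matrix.mem_unitaryGroup_iff]
    ext i j
    fin_cases i <;> fin_cases j <;> simp [Matrix.mul_apply, Fin.sum_univ_two, Matrix.star_apply]⟩

/-- The coordinate swap. -/
def swapPerm : SignedPerm :=
  ⟨!![0, 1; 1, 0], by
    rw [Matrix.mem_unitaryGroup_iff]
    ext i j
    fin_cases i <;> fin_cases j <;> simp [Matrix.mul_apply, Fin.sum_univ_two, Matrix.star_apply]⟩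

/-- The representation of the group with two elements defined by an idempotent `p`, mapping the
generator to `1 - 2 p`. -/
def symmetryHom {p : MatTwo} (hp : p * p = p) : ℤˣ →* MatTwo where
  toFun u := 1 + (((u : ℤ) : ℂ) - 1) • p
  map_one' := by simp
  map_mul' u v := by
    rw [add_mul, mul_add, mul_add, smul_mul_smul_comm, hp]
    simp only [one_mul, mul_one, Units.val_mul, Int.cast_mul]
    module

theorem symmetryHom_apply {p : MatTwo} (hp : p * p = p) (u : ℤˣ) :
    symmetryHom hp u = 1 + (((u : ℤ) : ℂ) - 1) • p := rfl

theorem norm_symmetryHom_le {p : MatTwo} (hp : p * p = p) {C : ℝ} (hC : 1 ≤ C)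
    (h : ‖1 - (2 : ℂ) • p‖ ≤ C) (u : ℤˣ) : ‖symmetryHom hp u‖ ≤ C := by
  obtain rfl | rfl := Int.units_eq_one_or u
  · rw [map_one]
    simpa using hC
  · rw [symmetryHom_apply]
    have : (1 : MatTwo) + ((((-1 : ℤˣ) : ℤ) : ℂ) - 1) • p = 1 - (2 : ℂ) • p := by
      have : ((((-1 : ℤˣ) : ℤ) : ℂ) - 1) = -2 := by norm_num
      rw [this, neg_smul, sub_eq_add_neg]
    rwa [this]

/-- A subalgebra containing the translates of reflection and swap at `n` contains all sequences
supported at `n`. -/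
theorem single_mem_of_perms {D : Subalgebra ℂ EllInftyM2} {n : ℕ}
    (hZ : lp.single ∞ n (signedPermHom reflectionPerm - 1) ∈ D)
    (hX : lp.single ∞ n (signedPermHom swapPerm - 1) ∈ D) (x : MatTwo) :
    (lp.single ∞ n x : EllInftyM2) ∈ D := by
  let D' : NonUnitalSubalgebra ℂ MatTwo :=
    { carrier := {y | (lp.single ∞ n y : EllInftyM2) ∈ D}
      add_mem' := fun {y z} hy hz => by
        rw [Set.mem_ofPred_eq, lp.single_add]
        exact add_mem hy hz
      zero_mem' := by
        rw [Set.mem_ofPred_eq, lp.single_zero]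
        exact zero_mem _
      mul_mem' := fun {y z} hy hz => by
        rw [Set.mem_ofPred_eq]
        have : (lp.single ∞ n (y * z) : EllInftyM2) = lp.single ∞ n y * lp.single ∞ n z := by
          refine EllInftyM2.ext fun k => ?_
          rw [EllInftyM2.mul_apply]
          by_cases hk : k = n
          · subst hk
            simp only [lp.single_apply_self]
          · simp only [lp.single_apply_ne _ _ _ hk, mul_zero]
        rw [this]
        exact mul_mem hy hz
      smul_mem' := fun c y hy => by
        rw [Set.mem_ofPred_eq, lp.single_smul]
        exact D.smul_mem hy c }
  have hZ' : signedPermHom reflectionPerm - 1 ∈ D' := hZ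
  have hX' : signedPermHom swapPerm - 1 ∈ D' := hX
  have h11 : Matrix.single 1 1 (1 : ℂ) ∈ D' := by
    have e : Matrix.single 1 1 (1 : ℂ) =
        (-1 / 2 : ℂ) • (signedPermHom reflectionPerm - 1) := by
      ext i j
      fin_cases i <;> fin_cases j <;> norm_num [signedPermHom, reflectionPerm, Matrix.single]
    rw [e]
    exact D'.smul_mem _ hZ'
  have h10 : Matrix.single 1 0 (1 : ℂ) ∈ D' := by
    convert add_mem (mul_mem h11 hX') h11 using 1
    ext i j
    fin_cases i <;> fin_cases j <;>
      norm_num [signedPermHom, swapPerm, Matrix.single, Matrix.mul_apply, Matrix.one_apply]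
  have h01 : Matrix.single 0 1 (1 : ℂ) ∈ D' := by
    convert add_mem (mul_mem hX' h11) h11 using 1
    ext i j
    fin_cases i <;> fin_cases j <;>
      norm_num [signedPermHom, swapPerm, Matrix.single, Matrix.mul_apply, Matrix.one_apply]
  have h00 : Matrix.single 0 0 (1 : ℂ) ∈ D' := by
    convert mul_mem h01 h10 using 1
    rw [Matrix.single_mul_single_same, mul_one]
  refine single_mem_of_matrixUnits (fun a b => ?_) x
  fin_cases a <;> fin_cases b
  exacts [h00, h01, h10, h11]

variable {J : Type*} {L : J → Set ℕ} {P : J → MatTwo} {S : Set J}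

open scoped Classical in
/-- The representation at the coordinate `n` of the finite group of signed permutations in the
first `N` coordinates and signs for the elements of `K`. -/
def blockRepAt (L : J → Set ℕ) (hP : ∀ j, P j * P j = P j) (N : ℕ) (K : Finset J) (n : ℕ) :
    (Fin N → SignedPerm) × (K → ℤˣ) →* MatTwo :=
  if h : n < N then
    (signedPermHom.comp (Pi.evalMonoidHom _ ⟨n, h⟩)).comp (MonoidHom.fst _ _)
  -- The choice of `j` is immaterial once N exceeds all pairwise intersections of the blocks in K,
  -- as is assumed wherever its value matters.
  else if h : ∃ j : K, n ∈ L j then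
    ((symmetryHom (hP h.choose)).comp (Pi.evalMonoidHom _ h.choose)).comp (MonoidHom.snd _ _)
  else 1

theorem norm_blockRepAt_le (hP : ∀ j, P j * P j = P j) {C : ℝ} (hC : 1 ≤ C)
    (h : ∀ j, ‖1 - (2 : ℂ) • P j‖ ≤ C) (N : ℕ) (K : Finset J) (n : ℕ)
    (g : (Fin N → SignedPerm) × (K → ℤˣ)) : ‖blockRepAt L hP N K n g‖ ≤ C := by
  unfold blockRepAt
  split_ifs with h1 h2
  · exact (norm_signedPermHom _).trans hC
  · exact norm_symmetryHom_le (hP _) hC (h _) _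
  · simpa using hC

theorem blockRepAt_of_lt (hP : ∀ j, P j * P j = P j) {N : ℕ} (K : Finset J) {n : ℕ} (hn : n < N)
    (g : (Fin N → SignedPerm) × (K → ℤˣ)) :
    blockRepAt L hP N K n g = signedPermHom (g.1 ⟨n, hn⟩) := by
  simp [blockRepAt, hn]

theorem blockRepAt_of_mem (hP : ∀ j, P j * P j = P j) {N : ℕ} {K : Finset J}
    (hK : ∀ i ∈ K, ∀ j ∈ K, i ≠ j → ∀ n ∈ L i ∩ L j, n < N) {n : ℕ} (hn : N ≤ n) (j : K)
    (hj : n ∈ L j) (g : (Fin N → SignedPerm) × (K → ℤˣ)) :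
    blockRepAt L hP N K n g = symmetryHom (hP j) (g.2 j) := by
  have h : ∃ j : K, n ∈ L j := ⟨j, hj⟩
  have hc : h.choose = j := by
    by_contra hne
    exact absurd (hK _ h.choose.2 _ j.2 (fun h => hne (Subtype.ext h)) n ⟨h.choose_spec, hj⟩)
      (not_lt.2 hn)
  unfold blockRepAt
  rw [dif_neg (not_lt.2 hn), dif_pos h]
  change symmetryHom (hP h.choose) (g.2 h.choose) = _
  rw [hc]

theorem blockRepAt_of_notMem (hP : ∀ j, P j * P j = P j) {N : ℕ} {K : Finset J} {n : ℕ}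
    (hn : N ≤ n) (h : ∀ j ∈ K, n ∉ L j) (g : (Fin N → SignedPerm) × (K → ℤˣ)) :
    blockRepAt L hP N K n g = 1 := by
  unfold blockRepAt
  rw [dif_neg (not_lt.2 hn), dif_neg]
  · rfl
  · rintro ⟨j, hj⟩
    exact h j j.2 hj

/-- The values of the finite group representation belong to the block algebra. -/
theorem boundedSeqHom_mem_blockAlgebra (hP : ∀ j, P j * P j = P j) {C : ℝ} (hC : 1 ≤ C)
    (h : ∀ j, ‖1 - (2 : ℂ) • P j‖ ≤ C) {N : ℕ} {K : Finset J} (hKS : (K : Set J) ⊆ S)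
    (hK : ∀ i ∈ K, ∀ j ∈ K, i ≠ j → ∀ n ∈ L i ∩ L j, n < N)
    (g : (Fin N → SignedPerm) × (K → ℤˣ)) :
    boundedSeqHom (blockRepAt L hP N K) C (norm_blockRepAt_le hP hC h N K) g ∈
      blockAlgebra L P S := by
  -- From N on the blocks in K are disjoint, so `y` agrees there with the group element.
  set y : EllInftyM2 := 1 + ∑ j : K, ((((g.2 j : ℤˣ) : ℤ) : ℂ) - 1) • blockSeq (L j) (P j) with hy
  have hyA : y ∈ blockAlgebra L P S := add_mem (one_mem _) (sum_mem fun j _ =>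
    Subalgebra.smul_mem _ (blockSeq_mem_blockAlgebra (hKS j.2)) _)
  rw [← sub_add_cancel (boundedSeqHom _ C _ g) y]
  refine add_mem (mem_blockAlgebra_of_support (N := N) fun n hn => ?_) hyA
  rw [EllInftyM2.sub_apply, boundedSeqHom_apply, hy, EllInftyM2.add_apply, EllInftyM2.one_apply,
    EllInftyM2.sum_apply]
  simp only [EllInftyM2.smul_apply]
  by_cases hex : ∃ j : K, n ∈ L j
  · obtain ⟨j, hj⟩ := hex
    rw [blockRepAt_of_mem hP hK hn j hj, symmetryHom_apply, Finset.sum_eq_single j,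
      blockSeq_apply_of_mem hj, sub_self]
    · intro i _ hij
      rw [blockSeq_apply_of_notMem, smul_zero]
      intro hi
      exact absurd (hK _ i.2 _ j.2 (fun h => hij (Subtype.ext h)) n ⟨hi, hj⟩) (not_lt.2 hn)
    · exact fun h => absurd (Finset.mem_univ _) h
  · rw [blockRepAt_of_notMem hP hn fun j hj hnj => hex ⟨⟨j, hj⟩, hnj⟩, Finset.sum_eq_zero,
      add_zero, sub_self]
    intro j _
    rw [blockSeq_apply_of_notMem fun hnj => hex ⟨j, hnj⟩, smul_zero]

/-- The finite group generates all sequences supported in the first `N` coordinates. -/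
theorem mem_adjoin_boundedSeqHom_of_support (hP : ∀ j, P j * P j = P j) {C : ℝ} (hC : 1 ≤ C)
    (h : ∀ j, ‖1 - (2 : ℂ) • P j‖ ≤ C) {N : ℕ} {K : Finset J} {x : EllInftyM2}
    (hx : ∀ n, N ≤ n → x n = 0) :
    x ∈ Algebra.adjoin ℂ (Set.range
      (boundedSeqHom (blockRepAt L hP N K) C (norm_blockRepAt_le hP hC h N K))) := by
  classical
  refine mem_of_single_mem (fun n hn => ?_) hx
  have key : ∀ u : SignedPerm, (lp.single ∞ n (signedPermHom u - 1) : EllInftyM2) ∈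
      Algebra.adjoin ℂ (Set.range
        (boundedSeqHom (blockRepAt L hP N K) C (norm_blockRepAt_le hP hC h N K))) := by
    intro u
    have e : (lp.single ∞ n (signedPermHom u - 1) : EllInftyM2) =
        boundedSeqHom (blockRepAt L hP N K) C (norm_blockRepAt_le hP hC h N K)
          (Pi.mulSingle ⟨n, hn⟩ u, 1) - 1 := by
      refine EllInftyM2.ext fun k => ?_
      rw [EllInftyM2.sub_apply, boundedSeqHom_apply, EllInftyM2.one_apply]
      by_cases hk : k < N
      · rw [blockRepAt_of_lt hP K hk]
        by_cases hkn : k = n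
        · subst hkn
          rw [lp.single_apply_self]
          dsimp only
          rw [Pi.mulSingle_eq_same]
        · rw [lp.single_apply_ne _ _ _ hkn]
          dsimp only
          rw [Pi.mulSingle_eq_of_ne (by simpa using hkn), map_one, sub_self]
      · have h1 : blockRepAt L hP N K k (Pi.mulSingle ⟨n, hn⟩ u, 1) = 1 := by
          unfold blockRepAt
          rw [dif_neg hk]
          split_ifs
          · simp
          · rfl
        rw [h1, lp.single_apply_ne _ _ _ (by omega), sub_self]
    rw [e]
    exact sub_mem (Algebra.subset_adjoin ⟨_, rfl⟩) (one_mem _)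
  exact single_mem_of_perms (key _) (key _)

/-- The finite group generates the block sequences of the elements of `K`. -/
theorem blockSeq_mem_adjoin_boundedSeqHom (hP : ∀ j, P j * P j = P j) {C : ℝ} (hC : 1 ≤ C)
    (h : ∀ j, ‖1 - (2 : ℂ) • P j‖ ≤ C) {N : ℕ} {K : Finset J}
    (hK : ∀ i ∈ K, ∀ j ∈ K, i ≠ j → ∀ n ∈ L i ∩ L j, n < N) {j : J} (hj : j ∈ K) :
    blockSeq (L j) (P j) ∈ Algebra.adjoin ℂ (Set.range
      (boundedSeqHom (blockRepAt L hP N K) C (norm_blockRepAt_le hP hC h N K))) := by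
  classical
  set ρ := boundedSeqHom (blockRepAt L hP N K) C (norm_blockRepAt_le hP hC h N K) with hρ
  -- Inverting the symmetry 1 - 2 P j recovers the block of `j` beyond N.
  set z : EllInftyM2 := (2⁻¹ : ℂ) • (1 - ρ (1, Pi.mulSingle (⟨j, hj⟩ : {x // x ∈ K}) (-1 : ℤˣ))) with hz
  have hzmem : z ∈ Algebra.adjoin ℂ (Set.range ρ) :=
    Subalgebra.smul_mem _ (sub_mem (one_mem _) (Algebra.subset_adjoin (Set.mem_range_self _))) _
  rw [← sub_add_cancel (blockSeq (L j) (P j)) z]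
  refine add_mem (mem_adjoin_boundedSeqHom_of_support hP hC h fun n hn => ?_) hzmem
  rw [EllInftyM2.sub_apply, hz, EllInftyM2.smul_apply, EllInftyM2.sub_apply, EllInftyM2.one_apply,
    hρ, boundedSeqHom_apply]
  by_cases hnj : n ∈ L j
  · rw [blockSeq_apply_of_mem hnj, blockRepAt_of_mem hP hK hn ⟨j, hj⟩ hnj]
    dsimp only
    rw [Pi.mulSingle_eq_same, symmetryHom_apply, Units.val_neg, Units.val_one, Int.cast_neg, Int.cast_one]
    module
  · rw [blockSeq_apply_of_notMem hnj]
    have h1 : blockRepAt L hP N K n (1, Pi.mulSingle (⟨j, hj⟩ : K) (-1)) = 1 := by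
      by_cases hex : ∃ i : K, n ∈ L i
      · obtain ⟨i, hi⟩ := hex
        have hij : i ≠ (⟨j, hj⟩ : K) := by
          rintro rfl
          exact hnj hi
        rw [blockRepAt_of_mem hP hK hn i hi]
        dsimp only
        rw [Pi.mulSingle_eq_of_ne hij, map_one]
      · exact blockRepAt_of_notMem hP hn (fun i hi hni => hex ⟨⟨i, hi⟩, hni⟩) _
    rw [h1, sub_self, smul_zero, sub_zero]

/-- The block algebra of almost disjoint sets and idempotents `P j` is `C ^ 2`-amenable if the
symmetries `1 - 2 P j` have norm at most `C`. -/
theorem isCAmenable_blockAlgebra (hL : ∀ i ∈ S, ∀ j ∈ S, i ≠ j → (L i ∩ L j).Finite)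
    (hP : ∀ j, P j * P j = P j) {C : ℝ} (hC : 1 ≤ C) (h : ∀ j, ‖1 - (2 : ℂ) • P j‖ ≤ C) :
    IsCAmenable (C ^ 2) (blockAlgebra L P S) := by
  classical
  set A := blockAlgebra L P S with hA
  let T : Set A := Subtype.val ⁻¹' blockGenerators L P S
  have hval : (fun a : A => (a : EllInftyM2)) '' T = blockGenerators L P S :=
    Subtype.image_preimage_coe _ _ |>.trans
      (Set.inter_eq_right.2 blockGenerators_subset_blockAlgebra)
  refine isCAmenable_of_finite_subsets T ?_ fun F => ?_
  · have himage : Subtype.val '' (Algebra.adjoin ℂ T : Set A) =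
        (Algebra.adjoin ℂ (blockGenerators L P S) : Set EllInftyM2) := by
      have := congrArg (fun D : Subalgebra ℂ EllInftyM2 => (D : Set EllInftyM2))
        (AlgHom.map_adjoin A.val T)
      rw [Subalgebra.coe_map] at this
      rw [← hval]
      exact this
    refine Subtype.dense_iff.2 ?_
    change _ ⊆ closure (Subtype.val '' (Algebra.adjoin ℂ T : Set A))
    rw [himage]
    exact subset_rfl
  have hT : ∀ x : T, ∃ (n : ℕ) (K : Finset J), (K : Set J) ⊆ S ∧
      ((∀ k, n ≤ k → (x : EllInftyM2) k = 0) ∨ ∃ j ∈ K, blockSeq (L j) (P j) = x) := by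
    rintro ⟨x, hx⟩
    obtain ⟨⟨n, a, b⟩, hx⟩ | ⟨j, hj, hx⟩ := hx
    · refine ⟨n + 1, ∅, by simp, Or.inl fun k hk => ?_⟩
      rw [← hx]
      exact lp.single_apply_ne _ _ _ (by omega)
    · exact ⟨0, {j}, by simpa using hj, Or.inr ⟨j, Finset.mem_singleton_self j, hx⟩⟩
  choose n K hKS hnK using hT
  let K₀ : Finset J := F.biUnion K
  have hK₀ : (K₀ : Set J) ⊆ S := by
    intro j hj
    obtain ⟨x, -, hx⟩ := Finset.mem_biUnion.1 (Finset.mem_coe.1 hj)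
    exact hKS x hx
  -- N lies past the supports of the matrix units in F and past all overlaps of the blocks involved.
  have hN : ∃ N, (∀ x ∈ F, n x ≤ N) ∧
      ∀ i ∈ K₀, ∀ j ∈ K₀, i ≠ j → ∀ n ∈ L i ∩ L j, n < N := by
    have hfin : (⋃ i ∈ K₀, ⋃ j ∈ K₀, ⋃ _ : i ≠ j, L i ∩ L j).Finite :=
      K₀.finite_toSet.biUnion fun i hi => K₀.finite_toSet.biUnion fun j hj =>
        Set.finite_iUnion fun hij => hL i (hK₀ hi) j (hK₀ hj) hij
    obtain ⟨M, hM⟩ := hfin.bddAbove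
    refine ⟨max (F.sup n) (M + 1), fun x hx => (Finset.le_sup hx).trans (le_max_left _ _),
      fun i hi j hj hij k hk => lt_of_lt_of_le (Nat.lt_succ_of_le (hM ?_)) (le_max_right _ _)⟩
    simp only [Set.mem_iUnion]
    exact ⟨i, hi, j, hj, hij, hk⟩
  obtain ⟨N, hNF, hNK⟩ := hN
  let ρ := boundedSeqHom (blockRepAt L hP N K₀) C (norm_blockRepAt_le hP hC h N K₀)
  let ρ' : (Fin N → SignedPerm) × (K₀ → ℤˣ) →* A :=
    ρ.codRestrict A (boundedSeqHom_mem_blockAlgebra hP hC h hK₀ hNK)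
  have hnorm : ∀ g, ‖(ρ' g : EllInftyM2)‖ ≤ C := fun g => 
    norm_boundedSeqHom_le _ C (norm_blockRepAt_le hP hC h N K₀) g
  obtain ⟨m, hm, h1, hcomm⟩ := exists_diagonal_of_finite_group ρ' (C := C ^ 2) fun g => by
    rw [pow_two]
    change ‖(ρ' g : EllInftyM2)‖ * ‖(ρ' g⁻¹ : EllInftyM2)‖ ≤ C * C
    exact mul_le_mul (hnorm g) (hnorm _) (norm_nonneg _) (by linarith)
  refine ⟨m, hm, h1, fun x hx => hcomm _ ?_⟩
  have hxρ : ((x : A) : EllInftyM2) ∈ Algebra.adjoin ℂ (Set.range ρ) := by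
    rcases hnK x with hx0 | ⟨j, hj, hjx⟩
    · exact mem_adjoin_boundedSeqHom_of_support hP hC h fun k hk => hx0 k ((hNF x hx).trans hk)
    · rw [← hjx]
      exact blockSeq_mem_adjoin_boundedSeqHom hP hC h hNK (Finset.mem_biUnion.2 ⟨x, hx, hj⟩)
  have himage : (fun a : A => (a : EllInftyM2)) '' Set.range ρ' = Set.range ρ := by
    rw [← Set.range_comp]
    rfl
  have hmap := AlgHom.map_adjoin A.val (Set.range ρ')
  change _ = Algebra.adjoin ℂ ((fun a : A => (a : EllInftyM2)) '' Set.range ρ') at hmap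
  rw [himage] at hmap
  rw [← hmap] at hxρ
  obtain ⟨a, ha, hax⟩ := Subalgebra.mem_map.1 hxρ
  rwa [← (Subtype.ext hax : a = x)]

end BlockAmenability

/-! ### Oblique idempotents and almost orthogonality. -/

section ObliqueIdempotents

/-- The idempotent with range `ℂ e₀` and kernel spanned by `(-s, 1)`. -/
def obliqueIdem (s : ℝ) : MatTwo := !![1, (s : ℂ); 0, 0]

theorem obliqueIdem_mul_self (s : ℝ) : obliqueIdem s * obliqueIdem s = obliqueIdem s := by
  ext i j
  fin_cases i <;> fin_cases j <;> simp [obliqueIdem]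

theorem star_obliqueIdem_zero : star (obliqueIdem 0) = obliqueIdem 0 := by
  ext i j
  fin_cases i <;> fin_cases j <;> simp [obliqueIdem, Matrix.star_apply]

/-- The shear with `obliqueIdem s = shear (-s) * obliqueIdem 0 * shear s`. -/
def shear (s : ℝ) : MatTwo := !![1, (s : ℂ); 0, 1]

theorem shear_mul_shear_neg (s : ℝ) : shear s * shear (-s) = 1 := by
  simp [shear, Matrix.one_fin_two]

theorem shear_neg_mul_shear (s : ℝ) : shear (-s) * shear s = 1 := by
  simp [shear, Matrix.one_fin_two]

theorem shear_mul_obliqueIdem_mul (s : ℝ) :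
    shear s * obliqueIdem s * shear (-s) = obliqueIdem 0 := by
  ext i j
  fin_cases i <;> fin_cases j <;> simp [shear, obliqueIdem]

theorem shear_neg_mul_obliqueIdem_mul (s : ℝ) :
    shear (-s) * obliqueIdem 0 * shear s = obliqueIdem s := by
  ext i j
  fin_cases i <;> fin_cases j <;> simp [shear, obliqueIdem]

theorem Matrix.norm_entry_le_l2_opNorm (x : MatTwo) (i j : Fin 2) : ‖x i j‖ ≤ ‖x‖ := by
  have h1 := Matrix.l2_opNorm_mulVec x (EuclideanSpace.single j (1 : ℂ))
  rw [PiLp.norm_single, norm_one, mul_one] at h1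
  refine le_trans ?_ h1
  have h2 := PiLp.norm_apply_le (WithLp.toLp 2 (x.mulVec (EuclideanSpace.single j (1 : ℂ)))
    : EuclideanSpace ℂ (Fin 2)) i
  simpa using h2

/-- The symmetry is a unitary times 1 + 2s e₀₁, and ‖e₀₁‖ ≤ 1. This is where the amenability
constant comes from. -/
theorem norm_one_sub_two_smul_obliqueIdem_le {s : ℝ} (hs : 0 ≤ s) :
    ‖1 - (2 : ℂ) • obliqueIdem s‖ ≤ 1 + 2 * s := by
  have e : 1 - (2 : ℂ) • obliqueIdem s =
      -signedPermHom reflectionPerm * (1 + ((2 * s : ℝ) : ℂ) • Matrix.single 0 1 1) := by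
    ext i j
    fin_cases i <;> fin_cases j <;>
      norm_num [signedPermHom, reflectionPerm, obliqueIdem, Matrix.mul_apply, Matrix.single,
        Matrix.one_apply]
  have hN : ‖(Matrix.single 0 1 1 : MatTwo)‖ ≤ 1 := by
    have h1 : (Matrix.single 0 1 1 : MatTwo) = signedPermHom swapPerm *
        Matrix.diagonal ![0, 1] := by
      ext i j
      fin_cases i <;> fin_cases j <;>
        norm_num [signedPermHom, swapPerm, Matrix.mul_apply, Matrix.single]
    rw [h1]
    refine (norm_mul_le _ _).trans (mul_le_one₀ (norm_signedPermHom _) (norm_nonneg _) ?_)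
    rw [Matrix.l2_opNorm_diagonal, pi_norm_le_iff_of_nonneg zero_le_one]
    intro i
    fin_cases i <;> simp
  rw [e]
  calc _ ≤ ‖-signedPermHom reflectionPerm‖ *
        ‖(1 : MatTwo) + ((2 * s : ℝ) : ℂ) • Matrix.single 0 1 1‖ := norm_mul_le _ _
    _ ≤ 1 * (1 + 2 * s * 1) := by
      rw [norm_neg]
      refine mul_le_mul (norm_signedPermHom _) ?_ (norm_nonneg _) zero_le_one
      refine (norm_add_le _ _).trans ?_
      rw [norm_smul, Complex.norm_real, Real.norm_of_nonneg (by positivity), norm_one]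
      gcongr
    _ = _ := by ring

/-- Here a, b, c, d are the entries of the form in a basis of range and kernel vectors, and (z, w)
is the second column of the adjoint. The lower bound on |ad| turns `h2` into |w| ≤ M² |z|, and then
`h1` bounds b. -/
theorem norm_le_of_two_equations {a b c d z w : ℂ} {M : ℝ} (h1 : a * z + b * w = b)
    (h2 : c * z + d * w = 0) (ha : ‖a‖ ≤ M) (hb : ‖b‖ ≤ M) (hc : ‖c‖ ≤ M)
    (had : 1 ≤ ‖a * d‖) : ‖b‖ ≤ (M + M ^ 3) * ‖z‖ := by
  have hM : 0 ≤ M := (norm_nonneg _).trans ha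
  have h3 : ‖d * w‖ ≤ M * ‖z‖ := by
    have : d * w = -(c * z) := by linear_combination h2
    rw [this, norm_neg, norm_mul]
    gcongr
  have h4 : ‖w‖ ≤ M ^ 2 * ‖z‖ := by
    calc ‖w‖ = 1 * ‖w‖ := (one_mul _).symm
      _ ≤ ‖a * d‖ * ‖w‖ := by gcongr
      _ = ‖a‖ * ‖d * w‖ := by rw [norm_mul, norm_mul, mul_assoc]
      _ ≤ M * (M * ‖z‖) := by gcongr
      _ = _ := by ring
  calc ‖b‖ = ‖a * z + b * w‖ := by rw [h1]
    _ ≤ ‖a * z‖ + ‖b * w‖ := norm_add_le _ _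
    _ = ‖a‖ * ‖z‖ + ‖b‖ * ‖w‖ := by rw [norm_mul, norm_mul]
    _ ≤ M * ‖z‖ + M * (M ^ 2 * ‖z‖) := by gcongr
    _ = _ := by ring

/-- The obstruction to commutation of `obliqueIdem s` with its adjoint with respect to a
hermitian form. -/
def shearEntry (s : ℝ) (x : MatTwo) : ℂ := x 0 1 + s * (x 1 1 - x 0 0) - s ^ 2 * x 1 0

/-- If the adjoint `y` of `obliqueIdem s` with respect to the form `h` nearly commutes with
`obliqueIdem s`, then the kernel and range of `obliqueIdem s` are nearly orthogonal with respect
to `h`. -/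
theorem norm_offdiag_le {h y : MatTwo} (hh : h.IsHermitian) (hdet : 1 ≤ h.det.re) {s : ℝ}
    (hs : 0 ≤ s) (hy : h * y = star (obliqueIdem s) * h) {M : ℝ} (hM : ‖h‖ * (1 + s) ≤ M) :
    ‖h 0 1 - s * h 0 0‖ ≤
      (M + M ^ 3) * ‖shearEntry s (obliqueIdem s * y - y * obliqueIdem s)‖ := by
  have hstar : star (obliqueIdem s) = !![1, 0; (s : ℂ), 0] := by
    ext i j
    fin_cases i <;> fin_cases j <;> simp [obliqueIdem, Matrix.star_apply]
  rw [hstar] at hy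
  have e1 := congrFun (congrFun hy 0) 0
  have e2 := congrFun (congrFun hy 0) 1
  have e3 := congrFun (congrFun hy 1) 0
  have e4 := congrFun (congrFun hy 1) 1
  simp only [Matrix.mul_apply, Fin.sum_univ_two, Matrix.of_apply, Matrix.cons_val',
    Matrix.cons_val_zero, Matrix.cons_val_one, Matrix.cons_val_fin_one] at e1 e2 e3 e4
  have hz : shearEntry s (obliqueIdem s * y - y * obliqueIdem s) =
      y 0 1 + s * (y 1 1 - y 0 0) - s ^ 2 * y 1 0 := by
    simp only [shearEntry, obliqueIdem, Matrix.sub_apply, Matrix.mul_apply, Fin.sum_univ_two,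
      Matrix.of_apply, Matrix.cons_val', Matrix.cons_val_zero, Matrix.cons_val_one,
      Matrix.cons_val_fin_one]
    ring
  rw [hz]
  have h0 : (starRingEnd ℂ) (h 0 0) = h 0 0 := hh.apply 0 0
  have h1 : (starRingEnd ℂ) (h 0 1) = h 1 0 := hh.apply 1 0
  have hentry : ∀ i j, ‖h i j‖ ≤ ‖h‖ := Matrix.norm_entry_le_l2_opNorm h
  have hb : ‖h 0 1 - s * h 0 0‖ ≤ M := by
    calc _ ≤ ‖h 0 1‖ + ‖(s : ℂ) * h 0 0‖ := norm_sub_le _ _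
      _ = ‖h 0 1‖ + s * ‖h 0 0‖ := by
        rw [norm_mul, Complex.norm_real, Real.norm_of_nonneg hs]
      _ ≤ ‖h‖ + s * ‖h‖ := by gcongr <;> exact hentry _ _
      _ = ‖h‖ * (1 + s) := by ring
      _ ≤ M := hM
  have hconj : h 1 0 - s * h 0 0 = (starRingEnd ℂ) (h 0 1 - s * h 0 0) := by
    rw [map_sub, map_mul, Complex.conj_ofReal, h0, h1]
  -- These are the entries of `h` and `y` in the basis e₀, e₁ - s e₀, where the idempotent becomes
  -- e₀₀.
  refine norm_le_of_two_equations (a := h 0 0) (c := h 1 0 - s * h 0 0)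
    (d := h 1 1 - s * h 0 1 - s * h 1 0 + s ^ 2 * h 0 0) (w := y 1 1 - s * y 1 0) ?_ ?_ ?_ hb ?_ ?_
  · linear_combination e2 - s * e1
  · linear_combination e4 - s * e3 - s * e2 + s ^ 2 * e1
  · refine (hentry 0 0).trans (le_trans ?_ hM)
    exact le_mul_of_one_le_right (norm_nonneg _) (by linarith)
  · rw [hconj, RCLike.norm_conj]
    exact hb
  -- The shear has determinant 1, so ad = det h + |b|².
  · have e : h 0 0 * (h 1 1 - s * h 0 1 - s * h 1 0 + s ^ 2 * h 0 0) =
        h.det + (Complex.normSq (h 0 1 - s * h 0 0) : ℂ) := by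
      rw [Complex.normSq_eq_conj_mul_self, ← hconj, Matrix.det_fin_two]
      ring
    rw [e]
    refine le_trans ?_ (Complex.re_le_norm _)
    rw [Complex.add_re, Complex.ofReal_re]
    have := Complex.normSq_nonneg (h 0 1 - s * h 0 0)
    linarith

theorem continuous_shearEntry (s : ℝ) : Continuous (shearEntry s) := by
  have h : ∀ i j, Continuous fun x : MatTwo => x i j := fun i j => continuous_id.matrix_elem i j
  exact (((h 0 1).add (continuous_const.mul ((h 1 1).sub (h 0 0)))).sub
    (continuous_const.mul (h 1 0)))

theorem shearEntry_zero (s : ℝ) : shearEntry s 0 = 0 := by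
  simp [shearEntry]

end ObliqueIdempotents

/-! ### The block algebra of a Luzin family is not a C*-algebra. -/

section NotCStar

/-- If a subalgebra of `ℓ∞(ℕ, M₂)` is isomorphic to a C*-algebra, then there are bounded hermitian
forms `h n`, with determinant bounded below, such that the algebra is closed under coordinatewise
adjoints with respect to `h n`. -/
theorem IsIsomorphicToCStarAlgebra.exists_forms {A : Subalgebra ℂ EllInftyM2}
    (hA : IsIsomorphicToCStarAlgebra A) :
    ∃ (h : ℕ → MatTwo) (C : ℝ), 1 ≤ C ∧ (∀ n, (h n).IsHermitian) ∧ (∀ n, ‖h n‖ ≤ C) ∧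
      (∀ n, C⁻¹ ≤ (h n 0 0).re) ∧ (∀ n, 1 ≤ (h n).det.re) ∧
      ∀ x ∈ A, ∃ y ∈ A, ∀ n, h n * y n = star (x n) * h n := by
  obtain ⟨B, _, ⟨Φ⟩⟩ := hA
  let ψ : B →ₐ[ℂ] EllInftyM2 := A.val.comp Φ.symm.toAlgEquiv.toAlgHom
  have hψA : ∀ b, ψ b ∈ A := fun b => (Φ.symm b).2
  have hψΦ : ∀ x : A, ψ (Φ x) = x := fun x => congrArg Subtype.val (Φ.symm_apply_apply x)
  have hψ : Continuous ψ := continuous_subtype_val.comp Φ.symm.continuous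
  let Ψ : B →L[ℂ] EllInftyM2 := ⟨ψ.toLinearMap, hψ⟩
  have hbound : ∀ u : unitary B, ‖ψ u‖ ≤ ‖Ψ‖ := by
    intro u
    have hu : ‖(u : B)‖ ≤ 1 := by
      cases subsingleton_or_nontrivial B
      · rw [Subsingleton.elim (u : B) 0, norm_zero]
        exact zero_le_one
      · exact (CStarRing.norm_coe_unitary u).le
    exact Ψ.le_of_opNorm_le_of_le le_rfl hu |>.trans (mul_one _).le
  let ρ : ℕ → unitary B →* MatTwo := fun n =>
    ((evalAlgHom n).comp ψ : B →* MatTwo).comp (unitary B).subtype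
  have hρ : ∀ n u, ρ n u = ψ u n := fun n u => rfl
  have hρC : ∀ n u, ‖ρ n u‖ ≤ ‖Ψ‖ := fun n u =>
    (EllInftyM2.norm_apply_le _ n).trans (hbound u)
  have hC1 : 1 ≤ ‖Ψ‖ := by simpa using hρC 0 1
  choose h hh hinv hnorm hdiag hdet using fun n => exists_invariant_form (ρ n) (hρC n)
  refine ⟨h, ‖Ψ‖ ^ 2, one_le_pow₀ hC1, hh, hnorm, fun n => hdiag n 0, hdet, fun x hx => ?_⟩
  -- Both sides are conjugate-linear in b and unitaries span B; for a unitary the identity is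
  -- invariance of the form.
  have key : ∀ n (b : B), h n * ψ (star b) n = star (ψ b n) * h n := by
    intro n b
    have hb : b ∈ Submodule.span ℂ (unitary B : Set B) := by
      rw [CStarAlgebra.span_unitary]
      trivial
    induction hb using Submodule.span_induction with
    | mem u hu =>
      have h1 : ψ u n * ψ (star u) n = 1 := by
        rw [← EllInftyM2.mul_apply, ← map_mul, Unitary.mul_star_self_of_mem hu, map_one]
        rfl
      have h2 := hinv n ⟨u, hu⟩
      rw [hρ] at h2
      calc h n * ψ (star u) n = (star (ψ u n) * h n * ψ u n) * ψ (star u) n := by rw [h2]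
        _ = star (ψ u n) * h n * (ψ u n * ψ (star u) n) := by rw [mul_assoc]
        _ = _ := by rw [h1, mul_one]
    | zero => simp
    | add x y _ _ hx hy =>
      rw [star_add, map_add, map_add, EllInftyM2.add_apply, EllInftyM2.add_apply, mul_add, hx, hy,
        star_add, add_mul]
    | smul c x _ hx =>
      rw [star_smul, map_smul, map_smul, EllInftyM2.smul_apply, EllInftyM2.smul_apply,
        mul_smul_comm, hx, star_smul, smul_mul_assoc]
  refine ⟨ψ (star (Φ ⟨x, hx⟩)), hψA _, fun n => ?_⟩
  rw [key, hψΦ]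

/-- The sets of a Luzin family of pairs, indexed by one index set. -/
def pairSets {I : Type*} (E F : I → Set ℕ) (j : I × Bool) : Set ℕ := cond j.2 (F j.1) (E j.1)

/-- The idempotents attached to the sets of a family of pairs. -/
def pairIdem {I : Type*} (s : ℝ) (j : I × Bool) : MatTwo := obliqueIdem (cond j.2 s 0)

theorem IsLuzinFamily.pairSets_inter_finite {I : Type*} {E F : I → Set ℕ} (h : IsLuzinFamily E F)
    (i j : I × Bool) (hij : i ≠ j) : (pairSets E F i ∩ pairSets E F j).Finite := by
  obtain ⟨i, b⟩ := i
  obtain ⟨j, c⟩ := j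
  by_cases hne : i = j
  · subst hne
    have hd := h.disjoint i
    cases b <;> cases c
    · exact absurd rfl hij
    · simp [pairSets, hd.inter_eq]
    · simp [pairSets, hd.symm.inter_eq]
    · exact absurd rfl hij
  · obtain ⟨h1, h2, h3, h4, -⟩ := h.rel i j hne
    cases b <;> cases c <;> assumption

theorem pairIdem_mul_self {I : Type*} (s : ℝ) (j : I × Bool) :
    pairIdem s j * pairIdem s j = pairIdem s j := obliqueIdem_mul_self _

theorem norm_one_sub_two_smul_pairIdem_le {I : Type*} {s : ℝ} (hs : 0 ≤ s) (j : I × Bool) :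
    ‖1 - (2 : ℂ) • pairIdem s j‖ ≤ 1 + 2 * s := by
  obtain ⟨i, _ | _⟩ := j
  · refine (norm_one_sub_two_smul_obliqueIdem_le le_rfl).trans ?_
    linarith
  · exact norm_one_sub_two_smul_obliqueIdem_le hs

/-- The block algebra of an uncountable Luzin family, with two different idempotents on the two
sides, is not isomorphic to a C*-algebra. -/
theorem IsLuzinFamily.not_isIsomorphicToCStarAlgebra {I : Type*} [Uncountable I]
    {E F : I → Set ℕ} (hEF : IsLuzinFamily E F) {s : ℝ} (hs : 0 < s) :
    ¬ IsIsomorphicToCStarAlgebra (blockAlgebra (pairSets E F) (pairIdem s) Set.univ) := by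
  intro hiso
  obtain ⟨h, C, hC1, hh, hnorm, hdiag, hdet, hadj⟩ := hiso.exists_forms
  have hcomm := blockAlgebra_subset_asymptoticCommutant (L := pairSets E F) (P := pairIdem s)
    (S := Set.univ) fun i _ j _ hij => hEF.pairSets_inter_finite i j hij
  have hev : ∀ j : I × Bool, ∀ δ > 0, ∀ᶠ n in atTop, n ∈ pairSets E F j →
      ‖h n 0 1 - (cond j.2 s 0 : ℝ) * h n 0 0‖ < δ := by
    intro j δ hδ
    set r : ℝ := cond j.2 s 0 with hr
    have hr0 : 0 ≤ r := by
      rw [hr]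
      cases j.2
      · exact le_rfl
      · exact hs.le
    have hx := blockSeq_mem_blockAlgebra (L := pairSets E F) (P := pairIdem s) (Set.mem_univ j)
    obtain ⟨y, hyA, hy⟩ := hadj _ hx
    have hnull := mem_nullSeq.1 (hcomm hx y hyA)
    have hlim := (((continuous_shearEntry r).tendsto 0).comp hnull).norm.const_mul
      (C * (1 + r) + (C * (1 + r)) ^ 3)
    rw [shearEntry_zero, norm_zero, mul_zero] at hlim
    filter_upwards [hlim.eventually (gt_mem_nhds hδ)] with n hn hnj
    refine lt_of_le_of_lt ?_ hn
    have hyn := hy n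
    rw [blockSeq_apply_of_mem hnj] at hyn
    have := norm_offdiag_le (hh n) (hdet n) hr0 hyn
      (mul_le_mul_of_nonneg_right (hnorm n) (by linarith : (0 : ℝ) ≤ 1 + r))
    refine this.trans (le_of_eq ?_)
    rw [Function.comp_apply, EllInftyM2.sub_apply, EllInftyM2.mul_apply, EllInftyM2.mul_apply,
      blockSeq_apply_of_mem hnj]
    rfl
  -- Half the lower bound of |s · h n 0 0|, to tell the limit 0 along E i from s · h n 0 0 along F
  -- i.
  have hδ : 0 < s * C⁻¹ / 2 := by positivity
  have hfin : ∀ p : ℕ → Prop, (∀ᶠ n in atTop, ¬ p n) → {n | p n}.Finite := by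
    intro p hp
    rw [← Nat.cofinite_eq_atTop, eventually_cofinite] at hp
    simpa using hp
  refine hEF.not_separated inferInstance {n | ‖h n 0 1‖ < s * C⁻¹ / 2} (fun i => ?_) fun i => ?_
  · refine hfin (fun n => n ∈ E i ∧ ¬ ‖h n 0 1‖ < s * C⁻¹ / 2) ?_
    filter_upwards [hev (i, false) _ hδ] with n hn hn'
    refine hn'.2 ?_
    simpa using hn hn'.1
  · refine hfin (fun n => n ∈ F i ∧ ‖h n 0 1‖ < s * C⁻¹ / 2) ?_
    filter_upwards [hev (i, true) _ hδ] with n hn hn'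
    have h1 := hn hn'.1
    have h2 := hn'.2
    have h3 : s * C⁻¹ ≤ ‖(s : ℂ) * h n 0 0‖ := by
      rw [norm_mul, Complex.norm_real, Real.norm_of_nonneg hs.le]
      have := (hdiag n).trans (Complex.re_le_norm _)
      gcongr
    have h4 : ‖(s : ℂ) * h n 0 0‖ ≤ ‖h n 0 1‖ + ‖h n 0 1 - s * h n 0 0‖ := by
      have := norm_sub_le (h n 0 1) (h n 0 1 - s * h n 0 0)
      rwa [sub_sub_cancel] at this
    simp only [cond_true] at h1
    linarith

end NotCStar

/-! ### The density character. -/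

section Density

theorem norm_obliqueIdem_zero_ge : 1 ≤ ‖obliqueIdem 0‖ := by
  have := Matrix.norm_entry_le_l2_opNorm (obliqueIdem 0) 0 0
  simpa [obliqueIdem] using this

theorem one_le_dist_blockSeq {S S' : Set ℕ} (h : S ≠ S') :
    1 ≤ dist (blockSeq S (obliqueIdem 0)) (blockSeq S' (obliqueIdem 0)) := by
  have key : ∀ S S' : Set ℕ, ∀ n ∈ S, n ∉ S' →
      1 ≤ dist (blockSeq S (obliqueIdem 0)) (blockSeq S' (obliqueIdem 0)) := by
    intro S S' n h1 h2
    have := EllInftyM2.norm_apply_le (blockSeq S (obliqueIdem 0) - blockSeq S' (obliqueIdem 0)) n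
    rw [EllInftyM2.sub_apply, blockSeq_apply_of_mem h1, blockSeq_apply_of_notMem h2,
      sub_zero] at this
    rw [dist_eq_norm]
    exact norm_obliqueIdem_zero_ge.trans this
  obtain ⟨n, hn⟩ | ⟨n, hn⟩ : (S \ S').Nonempty ∨ (S' \ S).Nonempty := by
    by_contra hcon
    rw [not_or, Set.not_nonempty_iff_eq_empty, Set.not_nonempty_iff_eq_empty,
      Set.sdiff_eq_empty, Set.sdiff_eq_empty] at hcon
    exact h (hcon.1.antisymm hcon.2)
  · exact key S S' n hn.1 hn.2
  · rw [dist_comm]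
    exact key S' S n hn.1 hn.2

theorem IsLuzinFamily.injective {I : Type*} {E F : I → Set ℕ} (h : IsLuzinFamily E F) :
    Function.Injective E := by
  intro i j hij
  by_contra hne
  obtain ⟨n, hn | hn⟩ := (h.rel i j hne).2.2.2.2
  · exact Set.disjoint_left.1 (h.disjoint j) (hij ▸ hn.1) hn.2
  · exact Set.disjoint_left.1 (h.disjoint i) (hij ▸ hn.2) hn.1

/-- A metric space with a `1`-separated family indexed by `I`, that is the closure of a union
of separable subsets indexed by `I`, where `I` is infinite, has density character `#I`. -/
theorem densityCharacter_eq_of_separated {X I : Type} [PseudoMetricSpace X] (hI : ℵ₀ ≤ #I)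
    (f : I → X) (hf : ∀ i j, i ≠ j → 1 ≤ dist (f i) (f j)) (T : I → Set X)
    (hT : ∀ i, TopologicalSpace.IsSeparable (T i)) (hd : Dense (⋃ i, T i)) :
    densityCharacter X = #I := by
  choose c hcT hc hTc using fun i => (hT i).exists_countable_dense_subset
  have hdense : Dense (⋃ i, c i) := by
    rw [dense_iff_closure_eq, Set.eq_univ_iff_forall]
    intro x
    refine closure_minimal (Set.iUnion_subset fun i => ?_) isClosed_closure (hd x)
    exact (hTc i).trans (closure_mono (Set.subset_iUnion c i))
  have hcard : #(⋃ i, c i) ≤ #I := by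
    refine (Cardinal.mk_iUnion_le_sum_mk).trans ?_
    refine (Cardinal.sum_le_sum _ (fun _ => ℵ₀) fun i => (hc i).le_aleph0).trans ?_
    rw [Cardinal.sum_const', Cardinal.mul_aleph0_eq hI]
  have hmem : #(⋃ i, c i) ∈ {κ : Cardinal | ∃ s : Set X, Dense s ∧ #s = κ} := ⟨_, hdense, rfl⟩
  refine le_antisymm ((csInf_le' hmem).trans hcard) ?_
  refine le_csInf ⟨_, hmem⟩ ?_
  rintro _ ⟨s, hs, rfl⟩
  -- Balls of radius 1/2 about the separated points are disjoint, and a dense set meets each.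
  choose g hg hfg using fun i => hs.exists_dist_lt (f i) (half_pos one_pos)
  refine Cardinal.mk_le_of_injective (f := fun i => (⟨g i, hg i⟩ : s)) fun i j hij => ?_
  by_contra hne
  have h1 := hf i j hne
  have h2 : g i = g j := congrArg Subtype.val hij
  have h3 := dist_triangle_right (f i) (f j) (g i)
  have h4 := hfg i
  have h5 := hfg j
  rw [← h2] at h5
  linarith

end Density

/-! ### Similarity over countable index sets and the final assembly. -/

section Main

/-- The unit of `ℓ∞(ℕ, M₂)` which is the shear by `s` on `X` and the identity elsewhere. -/
theorem exists_shearUnit (s : ℝ) (X : Set ℕ) :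
    ∃ v : EllInftyM2ˣ, (∀ n ∈ X, (v : EllInftyM2) n = shear s ∧
      (↑v⁻¹ : EllInftyM2) n = shear (-s)) ∧
      (∀ n ∉ X, (v : EllInftyM2) n = 1 ∧ (↑v⁻¹ : EllInftyM2) n = 1) ∧
      ‖(v : EllInftyM2)‖ ≤ ‖shear s‖ + 1 ∧ ‖(↑v⁻¹ : EllInftyM2)‖ ≤ ‖shear (-s)‖ + 1 := by
  classical
  have hb : ∀ r, ∀ n, ‖(if n ∈ X then shear r else 1 : MatTwo)‖ ≤ ‖shear r‖ + 1 := by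
    intro r n
    split_ifs
    · linarith
    · rw [norm_one]
      linarith [norm_nonneg (shear r)]
  let w : ℝ → EllInftyM2 := fun r => ⟨fun n => if n ∈ X then shear r else 1,
    memℓp_infty ⟨‖shear r‖ + 1, by rintro _ ⟨n, rfl⟩; exact hb r n⟩⟩
  have hw1 : ∀ r, ∀ n ∈ X, w r n = shear r := fun r n hn => if_pos hn
  have hw2 : ∀ r, ∀ n ∉ X, w r n = 1 := fun r n hn => if_neg hn
  have hmul : ∀ r r', shear r * shear r' = 1 → w r * w r' = 1 := by
    intro r r' hr
    refine EllInftyM2.ext fun n => ?_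
    rw [EllInftyM2.mul_apply, EllInftyM2.one_apply]
    by_cases hn : n ∈ X
    · rw [hw1 r n hn, hw1 r' n hn, hr]
    · rw [hw2 r n hn, hw2 r' n hn, one_mul]
  refine ⟨⟨w s, w (-s), hmul _ _ (shear_mul_shear_neg s), hmul _ _ (shear_neg_mul_shear s)⟩,
    fun n hn => ⟨hw1 s n hn, hw1 (-s) n hn⟩, fun n hn => ⟨hw2 s n hn, hw2 (-s) n hn⟩,
    lp.norm_le_of_forall_le' _ (hb s), lp.norm_le_of_forall_le' _ (hb (-s))⟩

/-- Block algebras over countable parts of a Luzin family are similar to C*-algebras, with a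
uniform bound. -/
theorem IsLuzinFamily.exists_similar_starSubalgebra {I : Type*} {E F : I → Set ℕ}
    (h : IsLuzinFamily E F) (s : ℝ) (S : Set I) (hS : S.Countable) :
    ∃ v : EllInftyM2ˣ, (∃ B : StarSubalgebra ℂ EllInftyM2, IsClosed (B : Set EllInftyM2) ∧
      (fun a : EllInftyM2 => (v : EllInftyM2) * a * (↑v⁻¹ : EllInftyM2)) ''
        (blockAlgebra (pairSets E F) (pairIdem s) {j | j.1 ∈ S} : Set EllInftyM2) =
          (B : Set EllInftyM2)) ∧
      ‖(v : EllInftyM2)‖ ≤ ‖shear s‖ + 1 ∧ ‖(↑v⁻¹ : EllInftyM2)‖ ≤ ‖shear (-s)‖ + 1 := by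
  obtain ⟨X, hX⟩ := h.exists_separation S hS
  obtain ⟨v, hvX, hvX', hv, hv'⟩ := exists_shearUnit s X
  have hfin : ∀ Y : Set ℕ, Y.Finite → ∃ N, ∀ n ∈ Y, n < N := by
    intro Y hY
    obtain ⟨N, hN⟩ := hY.bddAbove
    exact ⟨N + 1, fun n hn => Nat.lt_succ_of_le (hN hn)⟩
  -- Almost all of each F i lies in X, where the shear acts, and almost all of each E i lies
  -- outside.
  have hN : ∀ j : I × Bool, j.1 ∈ S → ∃ N : ℕ, ∀ n ∈ pairSets E F j, N ≤ n →
      (j.2 = true ↔ n ∈ X) := by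
    rintro ⟨i, _ | _⟩ hj
    · obtain ⟨N, hN⟩ := hfin _ (hX i hj).2
      refine ⟨N, fun n hn hNn => ?_⟩
      simp only [Bool.false_eq_true, false_iff]
      exact fun hnX => absurd (hN n ⟨hn, hnX⟩) (not_lt.2 hNn)
    · obtain ⟨N, hN⟩ := hfin _ (hX i hj).1
      refine ⟨N, fun n hn hNn => ?_⟩
      simp only [true_iff]
      by_contra hnX
      exact absurd (hN n ⟨hn, hnX⟩) (not_lt.2 hNn)
  set L := pairSets E F
  set S' : Set (I × Bool) := {j | j.1 ∈ S}
  let P₀ : I × Bool → MatTwo := fun _ => obliqueIdem 0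
  have hto : ∀ x ∈ blockAlgebra L (pairIdem s) S',
      (v : EllInftyM2) * x * (↑v⁻¹ : EllInftyM2) ∈ blockAlgebra L P₀ S' := by
    intro x hx
    refine conj_mem_blockAlgebra v (fun j hj => (hN j hj).imp fun N hN n hn hNn => ?_) hx
    have := hN n hn hNn
    obtain ⟨i, _ | _⟩ := j
    · obtain ⟨h1, h2⟩ := hvX' n (by simpa using this)
      rw [h1, h2, one_mul, mul_one]
      rfl
    · obtain ⟨h1, h2⟩ := hvX n (by simpa using this)
      rw [h1, h2]
      exact shear_mul_obliqueIdem_mul s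
  have hfrom : ∀ x ∈ blockAlgebra L P₀ S',
      (↑v⁻¹ : EllInftyM2) * x * (v : EllInftyM2) ∈ blockAlgebra L (pairIdem s) S' := by
    intro x hx
    have := conj_mem_blockAlgebra (P' := pairIdem s) v⁻¹
      (fun j hj => (hN j hj).imp fun N hN n hn hNn => ?_) hx
    · rwa [inv_inv] at this
    rw [inv_inv]
    have := hN n hn hNn
    obtain ⟨i, _ | _⟩ := j
    · obtain ⟨h1, h2⟩ := hvX' n (by simpa using this)
      rw [h1, h2, one_mul, mul_one]
      rfl
    · obtain ⟨h1, h2⟩ := hvX n (by simpa using this)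
      rw [h1, h2]
      exact shear_neg_mul_obliqueIdem_mul s
  refine ⟨v, ⟨{ blockAlgebra L P₀ S' with
    star_mem' := fun hx => star_mem_blockAlgebra (fun _ _ => star_obliqueIdem_zero) hx },
    isClosed_blockAlgebra, ?_⟩, hv, hv'⟩
  refine Set.Subset.antisymm ?_ fun x hx => ⟨_, hfrom x hx, ?_⟩
  · rintro _ ⟨x, hx, rfl⟩
    exact hto x hx
  · simp [mul_assoc]

/-- The index set for the construction. -/
abbrev FirstUncountable : Type := (ω₁ : Ordinal.{0}).ToType

theorem mk_firstUncountable : #FirstUncountable = ℵ₁ := by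
  rw [Cardinal.mk_toType, Ordinal.card_omega]

/-- Proper initial segments of ω₁ have cardinality below ℵ₁. Hence every stage of the inductive
limit involves a countable, separable subfamily. -/
theorem countable_Iic_firstUncountable (i : FirstUncountable) : (Set.Iic i).Countable := by
  rw [← Set.Iio_insert, Set.countable_insert, ← Cardinal.le_aleph0_iff_set_countable,
    ← Order.lt_succ_iff, Cardinal.succ_aleph0, ← mk_firstUncountable]
  refine Cardinal.mk_Iio_lt i ?_
  rw [mk_firstUncountable, Cardinal.ord_aleph, Ordinal.type_toType]

theorem IsCAmenable.mono {C C' : ℝ} (hC : C ≤ C') {A : Type} [NormedRing A] [NormedAlgebra ℂ A]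
    (h : IsCAmenable C A) : IsCAmenable C' A := by
  obtain ⟨ι, l, m, hl, hm, h1, h2⟩ := h
  exact ⟨ι, l, m, hl, fun i => (hm i).trans hC, h1, h2⟩

theorem iUnion_setOf_fst_mem_Iic :
    ⋃ i : FirstUncountable, {j : FirstUncountable × Bool | j.1 ∈ Set.Iic i} = Set.univ :=
  Set.eq_univ_of_forall fun j => Set.mem_iUnion.2 ⟨j.1, le_refl j.1⟩

theorem monotone_setOf_fst_mem_Iic :
    Monotone fun i : FirstUncountable => {j : FirstUncountable × Bool | j.1 ∈ Set.Iic i} :=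
  fun _ _ hij _ hk => le_trans (Set.mem_Iic.1 hk) hij

theorem IsLuzinFamily.closure_iUnion_blockAlgebra {E F : FirstUncountable → Set ℕ} (s : ℝ)
    [Nonempty FirstUncountable] :
    closure (⋃ i, (blockAlgebra (pairSets E F) (pairIdem s) {j | j.1 ∈ Set.Iic i} :
      Set EllInftyM2)) = (blockAlgebra (pairSets E F) (pairIdem s) Set.univ : Set EllInftyM2) := by
  rw [_root_.closure_iUnion_blockAlgebra monotone_setOf_fst_mem_Iic.directed_le,
    iUnion_setOf_fst_mem_Iic]

theorem countable_setOf_fst_mem {I : Type*} {S : Set I} (hS : S.Countable) :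
    {j : I × Bool | j.1 ∈ S}.Countable := by
  refine (hS.prod (Set.countable_univ (α := Bool))).mono fun j hj =>
    Set.mem_prod.2 ⟨hj, Set.mem_univ _⟩

theorem IsLuzinFamily.densityCharacter_blockAlgebra {E F : FirstUncountable → Set ℕ}
    (h : IsLuzinFamily E F) (s : ℝ) [Nonempty FirstUncountable] :
    densityCharacter (blockAlgebra (pairSets E F) (pairIdem s) Set.univ) = ℵ₁ := by
  rw [← mk_firstUncountable]
  let f : FirstUncountable → blockAlgebra (pairSets E F) (pairIdem s) Set.univ :=
    fun i => ⟨_, blockSeq_mem_blockAlgebra (Set.mem_univ (i, false))⟩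
  refine densityCharacter_eq_of_separated
    (by rw [mk_firstUncountable]; exact Cardinal.aleph0_le_aleph 1)
    f (fun i j hij => one_le_dist_blockSeq fun hE => hij (h.injective hE))
    (fun i => Subtype.val ⁻¹' (blockAlgebra (pairSets E F) (pairIdem s) {j | j.1 ∈ Set.Iic i} :
      Set EllInftyM2)) (fun i => ?_) ?_
  · exact Topology.IsInducing.subtypeVal.isSeparable_preimage
      (isSeparable_blockAlgebra (countable_setOf_fst_mem (countable_Iic_firstUncountable i)))
  · refine Subtype.dense_iff.2 ?_
    have himage : ∀ t ⊆ (blockAlgebra (pairSets E F) (pairIdem s) Set.univ : Set EllInftyM2),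
        (fun a : blockAlgebra (pairSets E F) (pairIdem s) Set.univ => (a : EllInftyM2)) ''
          (Subtype.val ⁻¹' t) = t := fun t ht =>
      (Subtype.image_preimage_coe _ _).trans (Set.inter_eq_right.2 ht)
    rw [← Set.preimage_iUnion]
    refine (Set.Subset.trans ?_ (closure_mono (himage _ ?_).ge))
    · exact (IsLuzinFamily.closure_iUnion_blockAlgebra s).ge
    · exact Set.iUnion_subset fun i => blockAlgebra_mono (Set.subset_univ _)

end Main

end

theorem theorem1 (ε : ℝ) (hε : 0 < ε) :
    ∃ A : Subalgebra ℂ EllInftyM2,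
      IsClosed (A : Set EllInftyM2) ∧
      IsAmenableBanachAlgebra A ∧
      IsCAmenable (1 + ε) A ∧
      ¬ IsIsomorphicToCStarAlgebra A ∧
      densityCharacter A = ℵ₁ ∧
      ∃ (𝒜 : Set.Iio (ω₁ : Ordinal.{0}) → Subalgebra ℂ EllInftyM2)
        (v : Set.Iio (ω₁ : Ordinal.{0}) → EllInftyM2ˣ),
        Monotone 𝒜 ∧
        closure (⋃ i, (𝒜 i : Set EllInftyM2)) = (A : Set EllInftyM2) ∧
        (∀ i, IsClosed (𝒜 i : Set EllInftyM2) ∧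
          TopologicalSpace.IsSeparable (𝒜 i : Set EllInftyM2)) ∧
        (∀ i, ∃ B : StarSubalgebra ℂ EllInftyM2, IsClosed (B : Set EllInftyM2) ∧
          (fun a : EllInftyM2 => (v i : EllInftyM2) * a * ((v i)⁻¹ : EllInftyM2ˣ)) ''
            (𝒜 i : Set EllInftyM2) = (B : Set EllInftyM2)) ∧
        BddAbove (Set.range fun i =>
          ‖(v i : EllInftyM2)‖ * ‖(((v i)⁻¹ : EllInftyM2ˣ) : EllInftyM2)‖) := by
  have hω : Nonempty FirstUncountable := by
    rw [← Cardinal.mk_ne_zero_iff, mk_firstUncountable]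
    exact (Cardinal.aleph_pos 1).ne'
  have hunc : Uncountable FirstUncountable := by
    rw [← Cardinal.aleph0_lt_mk_iff, mk_firstUncountable]
    exact Cardinal.aleph0_lt_aleph_one
  obtain ⟨E, F, hEF⟩ := exists_isLuzinFamily_of_card mk_firstUncountable
  obtain ⟨s, hs, hsε⟩ : ∃ s : ℝ, 0 < s ∧ (1 + 2 * s) ^ 2 ≤ 1 + ε := by
    -- With t = min(1, ε), (1 + t/4)² = 1 + t/2 + t²/16 ≤ 1 + t because t ≤ 1.
    refine ⟨min 1 ε / 8, by positivity, ?_⟩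
    have h1 := min_le_left 1 ε
    have h2 := min_le_right 1 ε
    have h3 : 0 < min 1 ε := by positivity
    nlinarith
  have hamen : IsCAmenable (1 + ε) (blockAlgebra (pairSets E F) (pairIdem s) Set.univ) :=
    (isCAmenable_blockAlgebra (fun i _ j _ hij => hEF.pairSets_inter_finite i j hij)
      (pairIdem_mul_self s) (by linarith) (norm_one_sub_two_smul_pairIdem_le hs.le)).mono hsε
  choose v hv hv1 hv2 using fun i : FirstUncountable =>
    hEF.exists_similar_starSubalgebra s (Set.Iic i) (countable_Iic_firstUncountable i)
  let e : Set.Iio (ω₁ : Ordinal.{0}) ≃o FirstUncountable := Ordinal.ToType.mk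
  refine ⟨blockAlgebra (pairSets E F) (pairIdem s) Set.univ, isClosed_blockAlgebra,
    hamen.isAmenableBanachAlgebra, hamen, hEF.not_isIsomorphicToCStarAlgebra hs,
    hEF.densityCharacter_blockAlgebra s,
    fun i => blockAlgebra (pairSets E F) (pairIdem s) {j | j.1 ∈ Set.Iic (e i)},
    fun i => v (e i), fun i j hij => blockAlgebra_mono (monotone_setOf_fst_mem_Iic (e.monotone hij)),
    ?_, fun i => ⟨isClosed_blockAlgebra, isSeparable_blockAlgebra
      (countable_setOf_fst_mem (countable_Iic_firstUncountable _))⟩, fun i => hv (e i), ?_⟩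
  · rw [← IsLuzinFamily.closure_iUnion_blockAlgebra s]
    exact congrArg closure (e.surjective.iUnion_comp
      fun i => (blockAlgebra (pairSets E F) (pairIdem s) {j | j.1 ∈ Set.Iic i} : Set EllInftyM2))
  · refine ⟨(‖shear s‖ + 1) * (‖shear (-s)‖ + 1), ?_⟩
    rintro _ ⟨i, rfl⟩
    exact mul_le_mul (hv1 _) (hv2 _) (norm_nonneg _) (by positivity)
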